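/- For a finite connected simple graph $G$, an edge $e=uv$ of $G$ and an edge $f=ab$ of $G$, let $d(f,u)=\min\{d(a,u),d(b,u)\}$, let $m_u(e|G)$ be the number of edges $f$ of $G$ with $d(f,u)<d(f,v)$, define $m_v(e|G)$ symmetrically, and let $$Mo_e(G)=\sum_{e=uv\in E(G)}|m_u(e|G)-m_v(e|G)|$$ be the edge Mostar index of $G$. A connected graph is bicyclic if it has exactly one more edge than vertices; its size is its number of edges. Let $\Theta(a,b,c)$ be the graph formed by three internally disjoint paths of lengths $a,b,c$ between the same two vertices. Define the following graphs of size $m$: - $B_m$ ($m\ge 8$): two 4-cycles sharing one vertex, with $m-8$ pendent edges attached at that vertex; - $B^1_m$ ($m\ge 7$): a 4-cycle and a triangle sharing one vertex, with $m-7$ pendent edges attached at that vertex; - $B^2_m$ ($m\ge 6$): two triangles sharing one vertex, with $m-6$ pendent edges attached at that vertex; - $B^3_m$ and $B^4_m$ ($m\ge 5$): $\Theta(1,2,2)$ ($K_4$ minus an edge) with $m-5$ pendent edges attached at one vertex of degree 3, respectively of degree 2, of $\Theta(1,2,2)$; - $B^5_m$ ($m\ge 6$): $\Theta(2,2,2)=K_{2,3}$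 with $m-6$ pendent edges attached at one vertex of degree 2 of $\Theta(2,2,2)$. **Theorem.** Let $G$ be a bicyclic graph of size $m\ge 5$. Then $$Mo_e(G)\le\begin{cases}4, & m=5,\text{ with equality iff } G\cong B^3_m \text{ or } G\cong B^4_m \text{ (these two coincide)};\\ m^2-3m-6, & 6\le m\le 8,\text{ with equality iff } G\cong B^2_m\text{ or }G\cong B^3_m;\\ 48, & m=9,\text{ with equality iff } G\cong B_m,\ B^1_m,\ B^2_m,\ B^3_m\text{ or } B^4_m;\\ m^2-m-24, & m\ge 10,\text{ with equality iff } G\cong B_m.\end{cases}$$ In particular, for every $m\ge 10$, $B_m$ has the maximum edge Mostar index among all bicyclic graphs of size $m$, whereas $B^5_m$ is a bicyclic graph of size $m$ that does not. This disproves the conjecture of Liu et al. that, for all sufficiently large $m$, both $B_m$ and $B^5_m$ have the maximum edge Mostar index among bicyclic graphs of size $m$. -/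

import Mathlib

namespace EdgeMostar

/-- The distance from the edge `f` to the vertex `w`: the smaller of the distances from the two
ends of `f` to `w`. -/
noncomputable def edgeDist {V : Type*} (G : SimpleGraph V) (f : Sym2 V) (w : V) : ℕ :=
  Sym2.lift ⟨fun a b => min (G.dist a w) (G.dist b w), fun _ _ => min_comm _ _⟩ f

open Classical in
/-- The number of edges of `G` that lie closer to `u` than to `v`. -/
noncomputable def closerEdges {V : Type*} [Fintype V] (G : SimpleGraph V) (u v : V) : ℕ :=
  (G.edgeFinset.filter fun f => edgeDist G f u < edgeDist G f v).card

/-- The contribution `|m_u(e|G) - m_v(e|G)|` of `e = uv`. -/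
noncomputable def contribution {V : Type*} [Fintype V] (G : SimpleGraph V) (e : Sym2 V) : ℤ :=
  Sym2.lift ⟨fun u v => |(closerEdges G u v : ℤ) - (closerEdges G v u : ℤ)|,
    fun _ _ => abs_sub_comm _ _⟩ e

open Classical in
/-- The edge Mostar index `Mo_e(G)`: the sum of the contributions of all edges. -/
noncomputable def edgeMostar {V : Type*} [Fintype V] (G : SimpleGraph V) : ℤ :=
  ∑ e ∈ G.edgeFinset, contribution G e

/-- A bicyclic graph of size `m`: a connected graph with `m` edges, one more edge than it has
vertices. -/
def IsBicyclic {V : Type*} [Fintype V] (G : SimpleGraph V) (m : ℕ) : Prop :=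
  G.Connected ∧ G.edgeSet.ncard = Fintype.card V + 1 ∧ G.edgeSet.ncard = m

/-- The graph obtained from `H` by attaching `p` pendent vertices at the vertex `v`. -/
def attachPendants {V : Type*} (H : SimpleGraph V) (v : V) (p : ℕ) : SimpleGraph (V ⊕ Fin p) where
  Adj x y := match x, y with
    | .inl a, .inl b => H.Adj a b
    | .inl a, .inr _ => a = v
    | .inr _, .inl b => b = v
    | .inr _, .inr _ => False
  symm := ⟨by
    rintro (a | i) (b | j) h
    · exact H.adj_symm h
    · exact h
    · exact h
    · exact h⟩
  loopless := ⟨by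
    rintro (a | i) h
    · exact H.loopless.irrefl a h
    · exact h⟩

/-- Two 4-cycles sharing the vertex `0`. -/
def twoSquares : SimpleGraph (Fin 7) :=
  SimpleGraph.fromEdgeSet
    {s(0, 1), s(1, 2), s(2, 3), s(3, 0), s(0, 4), s(4, 5), s(5, 6), s(6, 0)}

/-- A 4-cycle and a triangle sharing the vertex `0`. -/
def squareTriangle : SimpleGraph (Fin 6) :=
  SimpleGraph.fromEdgeSet {s(0, 1), s(1, 2), s(2, 3), s(3, 0), s(0, 4), s(4, 5), s(5, 0)}

/-- Two triangles sharing the vertex `0`. -/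
def twoTriangles : SimpleGraph (Fin 5) :=
  SimpleGraph.fromEdgeSet {s(0, 1), s(1, 2), s(2, 0), s(0, 3), s(3, 4), s(4, 0)}

/-- The graph `Θ(1,2,2)`, that is, `K₄` minus an edge; `0, 1` have degree 3, `2, 3` degree 2. -/
def diamond : SimpleGraph (Fin 4) :=
  SimpleGraph.fromEdgeSet {s(0, 1), s(0, 2), s(2, 1), s(0, 3), s(3, 1)}

/-- The graph `Θ(2,2,2) = K_{2,3}`; `0, 1` have degree 3 and `2, 3, 4` have degree 2. -/
def thetaTwo : SimpleGraph (Fin 5) :=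
  SimpleGraph.fromEdgeSet {s(0, 2), s(2, 1), s(0, 3), s(3, 1), s(0, 4), s(4, 1)}

/-- `B_m` (size `m` when `8 ≤ m`). -/
def B (m : ℕ) : SimpleGraph (Fin 7 ⊕ Fin (m - 8)) := attachPendants twoSquares 0 (m - 8)

/-- `B¹_m` (size `m` when `7 ≤ m`). -/
def B1 (m : ℕ) : SimpleGraph (Fin 6 ⊕ Fin (m - 7)) := attachPendants squareTriangle 0 (m - 7)

/-- `B²_m` (size `m` when `6 ≤ m`). -/
def B2 (m : ℕ) : SimpleGraph (Fin 5 ⊕ Fin (m - 6)) := attachPendants twoTriangles 0 (m - 6)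

/-- `B³_m` (size `m` when `5 ≤ m`): the pendent edges are at a vertex of degree 3. -/
def B3 (m : ℕ) : SimpleGraph (Fin 4 ⊕ Fin (m - 5)) := attachPendants diamond 0 (m - 5)

/-- `B⁴_m` (size `m` when `5 ≤ m`): the pendent edges are at a vertex of degree 2. -/
def B4 (m : ℕ) : SimpleGraph (Fin 4 ⊕ Fin (m - 5)) := attachPendants diamond 2 (m - 5)

/-- `B⁵_m` (size `m` when `6 ≤ m`): the pendent edges are at a vertex of degree 2. -/
def B5 (m : ℕ) : SimpleGraph (Fin 5 ⊕ Fin (m - 6)) := attachPendants thetaTwo 2 (m - 6)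

/-- `G` and `H` are isomorphic. -/
def Isom {V W : Type*} (G : SimpleGraph V) (H : SimpleGraph W) : Prop := Nonempty (G ≃g H)

/-- `H` is a bicyclic graph of size `m` with the maximum edge Mostar index among all bicyclic
graphs of size `m` (every finite graph is isomorphic to a graph on some `Fin n`). -/
def IsMaximizer {W : Type*} [Fintype W] (H : SimpleGraph W) (m : ℕ) : Prop :=
  IsBicyclic H m ∧
    ∀ (n : ℕ) (G : SimpleGraph (Fin n)), IsBicyclic G m → edgeMostar G ≤ edgeMostar H

/-- The conjecture of Liu et al.: for all sufficiently large `m`, both `B_m` and `B⁵_m` have the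
maximum edge Mostar index among bicyclic graphs of size `m`. -/
def LiuConjecture : Prop :=
  ∃ M : ℕ, ∀ m : ℕ, M ≤ m → IsMaximizer (B m) m ∧ IsMaximizer (B5 m) m

end EdgeMostar

/-!
In a connected graph with `m` edges, `Mo_e(G) = m (m - 1) - D(G)`, where `D(G)` sums over the
edges `uv` the deficiency `m - 1 - |m_u - m_v| ≥ 0`, so the task is to minimise `D`. The edges of
a triangle have total deficiency at least `m + 3` and those of a quadrangle at least `12`, while
an edge that lies on a cycle but on no triangle or quadrangle has deficiency at least `4`. These
costs force a bicyclic graph with `D(G) ≤ min(24, 2m + 6)` to contain two short cycles that meet,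
hence one of a few small bicyclic cores. For each core, `D(G)` is bounded below by a piecewise
linear function of the numbers of outside edges hanging at the vertices of the core, and the
graphs attaining this bound with all weight at one core vertex have only pendent edges outside the
core.
-/

namespace EdgeMostar

open SimpleGraph Finset

section EdgeDistances

variable {V : Type*} {G : SimpleGraph V} {u v : V}

@[simp] lemma edgeDist_mk (G : SimpleGraph V) (a b w : V) :
    edgeDist G s(a, b) w = min (G.dist a w) (G.dist b w) := rfl

lemma edgeDist_le_add_one (h : G.Adj u v) (f : Sym2 V) :
    edgeDist G f u ≤ edgeDist G f v + 1 := by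
  induction f with | _ a b
  have ha := h.diff_dist_adj (u := a)
  have hb := h.diff_dist_adj (u := b)
  simp only [edgeDist_mk]
  omega

lemma edgeDist_eq_zero (hG : G.Connected) {f : Sym2 V} : edgeDist G f v = 0 ↔ v ∈ f := by
  induction f with | _ a b
  rw [edgeDist_mk, Sym2.mem_iff, Nat.min_eq_zero_iff, hG.dist_eq_zero_iff, hG.dist_eq_zero_iff,
    eq_comm, @eq_comm _ b]

lemma edgeDist_lt_of_mem_of_notMem (hG : G.Connected) {f : Sym2 V} (hu : u ∈ f) (hv : v ∉ f) :
    edgeDist G f u < edgeDist G f v := by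
  rw [(edgeDist_eq_zero hG).2 hu, Nat.pos_iff_ne_zero]
  exact mt (edgeDist_eq_zero hG).1 hv

lemma edgeDist_eq_one (hG : G.Connected) {f : Sym2 V} (hu : u ∈ f) (huv : G.Adj u v)
    (hv : v ∉ f) : edgeDist G f v = 1 := by
  have hpos := mt (edgeDist_eq_zero hG).1 hv
  have hle := edgeDist_le_add_one huv.symm f
  rw [(edgeDist_eq_zero hG).2 hu] at hle
  omega

lemma dist_lt_dist_of_pendant (hG : G.Connected) (hv : ∀ y, G.Adj v y → y = u) {x : V}
    (hx : x ≠ v) : G.dist x u < G.dist x v := by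
  obtain ⟨p, hp⟩ := hG.exists_walk_length_eq_dist v x
  cases p with
  | nil => exact absurd rfl hx
  | cons h p =>
    obtain rfl := hv _ h
    rw [dist_comm, G.dist_comm (u := x), ← hp, Walk.length_cons]
    exact Nat.lt_succ_of_le (dist_le p)

end EdgeDistances

section ShortCycles

variable {V : Type*} {G : SimpleGraph V} {p q r s : V}

/-- `p, q, r` are the vertices of a 3-cycle. -/
structure IsTriangle (G : SimpleGraph V) (p q r : V) : Prop where
  adj₁₂ : G.Adj p q
  adj₂₃ : G.Adj q r
  adj₃₁ : G.Adj r p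

/-- `p, q, r, s` are the vertices of a 4-cycle, in cyclic order. -/
structure IsQuadrangle (G : SimpleGraph V) (p q r s : V) : Prop where
  adj₁₂ : G.Adj p q
  adj₂₃ : G.Adj q r
  adj₃₄ : G.Adj r s
  adj₄₁ : G.Adj s p
  ne₁₃ : p ≠ r
  ne₂₄ : q ≠ s

lemma IsTriangle.rotate (h : IsTriangle G p q r) : IsTriangle G q r p :=
  ⟨h.adj₂₃, h.adj₃₁, h.adj₁₂⟩

lemma IsTriangle.reverse (h : IsTriangle G p q r) : IsTriangle G r q p :=
  ⟨h.adj₂₃.symm, h.adj₁₂.symm, h.adj₃₁.symm⟩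

lemma IsQuadrangle.rotate (h : IsQuadrangle G p q r s) : IsQuadrangle G q r s p :=
  ⟨h.adj₂₃, h.adj₃₄, h.adj₄₁, h.adj₁₂, h.ne₂₄, h.ne₁₃.symm⟩

lemma IsQuadrangle.reverse (h : IsQuadrangle G p q r s) : IsQuadrangle G s r q p :=
  ⟨h.adj₃₄.symm, h.adj₂₃.symm, h.adj₁₂.symm, h.adj₄₁.symm, h.ne₂₄.symm, h.ne₁₃.symm⟩

end ShortCycles

section Deficiency

lemma card_edgeFinset_eq_ncard {V : Type*} (G : SimpleGraph V) [Fintype G.edgeSet] :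
    #G.edgeFinset = G.edgeSet.ncard := by
  rw [← coe_edgeFinset, Set.ncard_coe_finset]

variable {V : Type*} [Fintype V] {G : SimpleGraph V} {u v p q r s : V}

open Classical in
/-- The sum of the distances from all edges to the vertex `v`. The contribution of an edge is the
absolute difference of the transmissions of its ends. -/
noncomputable def transmission (G : SimpleGraph V) (v : V) : ℤ :=
  ∑ f ∈ G.edgeFinset, (edgeDist G f v : ℤ)

open Classical in
/-- The number of edges of `G` at the same distance from `u` and from `v`. -/
noncomputable def equidistantEdges (G : SimpleGraph V) (u v : V) : ℕ :=
  #{f ∈ G.edgeFinset | edgeDist G f u = edgeDist G f v}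

/-- The amount by which the contribution of `e` falls short of the trivial bound `m - 1` in a graph
with `m` edges. -/
noncomputable def deficiency (G : SimpleGraph V) (e : Sym2 V) : ℤ :=
  G.edgeSet.ncard - 1 - contribution G e

open Classical in
/-- The sum of the deficiencies of all edges, that is, the amount by which the edge Mostar index
falls short of `m (m - 1)` in a graph with `m` edges. -/
noncomputable def totalDeficiency (G : SimpleGraph V) : ℤ := ∑ e ∈ G.edgeFinset, deficiency G e

lemma edgeMostar_eq_sub_totalDeficiency (G : SimpleGraph V) :
    edgeMostar G = G.edgeSet.ncard * (G.edgeSet.ncard - 1) - totalDeficiency G := by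
  simp only [edgeMostar, totalDeficiency, deficiency, Finset.sum_sub_distrib, sum_const,
    nsmul_eq_mul, card_edgeFinset_eq_ncard]
  ring

lemma contribution_eq_abs_transmission_sub (h : G.Adj u v) :
    contribution G s(u, v) = |transmission G u - transmission G v| := by
  have key : (closerEdges G u v : ℤ) - closerEdges G v u =
      transmission G v - transmission G u := by
    simp only [closerEdges, transmission, card_filter, Nat.cast_sum, ← Finset.sum_sub_distrib]
    refine sum_congr rfl fun f _ => ?_
    have hu := edgeDist_le_add_one h f
    have hv := edgeDist_le_add_one h.symm f
    split_ifs <;> push_cast <;> omega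
  rw [abs_sub_comm, ← key]
  rfl

lemma deficiency_eq_sub_abs_transmission_sub (h : G.Adj u v) :
    deficiency G s(u, v) =
      G.edgeSet.ncard - 1 - |transmission G u - transmission G v| := by
  rw [deficiency, contribution_eq_abs_transmission_sub h]

lemma closerEdges_add_closerEdges_add_equidistantEdges (G : SimpleGraph V) (u v : V) :
    closerEdges G u v + closerEdges G v u + equidistantEdges G u v = G.edgeSet.ncard := by
  classical
  simp only [closerEdges, equidistantEdges, card_filter, ← sum_add_distrib]
  rw [← card_edgeFinset_eq_ncard, card_eq_sum_ones]
  refine sum_congr rfl fun f _ => ?_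
  split_ifs <;> omega

lemma deficiency_eq_two_mul_min_add (G : SimpleGraph V) (u v : V) :
    deficiency G s(u, v) =
      2 * min (closerEdges G u v) (closerEdges G v u) + equidistantEdges G u v - 1 := by
  have hsum := closerEdges_add_closerEdges_add_equidistantEdges G u v
  have hcontr : contribution G s(u, v) = |(closerEdges G u v : ℤ) - closerEdges G v u| := rfl
  rw [deficiency, hcontr, abs_eq_max_neg]
  omega

lemma card_le_closerEdges {A : Finset (Sym2 V)} (hA : ∀ f ∈ A, f ∈ G.edgeSet)
    (hd : ∀ f ∈ A, edgeDist G f u < edgeDist G f v) : #A ≤ closerEdges G u v := by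
  classical
  exact card_le_card fun f hf => mem_filter.2 ⟨mem_edgeFinset.2 (hA f hf), hd f hf⟩

lemma card_le_equidistantEdges {A : Finset (Sym2 V)} (hA : ∀ f ∈ A, f ∈ G.edgeSet)
    (hd : ∀ f ∈ A, edgeDist G f u = edgeDist G f v) : #A ≤ equidistantEdges G u v := by
  classical
  exact card_le_card fun f hf => mem_filter.2 ⟨mem_edgeFinset.2 (hA f hf), hd f hf⟩

lemma closerEdges_pos (hG : G.Connected) (huv : u ≠ v) {x : V} (hx : G.Adj u x) (hxv : x ≠ v) :
    1 ≤ closerEdges G u v := by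
  refine card_le_closerEdges (A := {s(u, x)}) (by simpa using hx) ?_
  simp only [mem_singleton, forall_eq]
  exact edgeDist_lt_of_mem_of_notMem hG (Sym2.mem_mk_left u x) (by simp [huv.symm, hxv.symm])

lemma equidistantEdges_pos (hG : G.Connected) (h : G.Adj u v) : 1 ≤ equidistantEdges G u v := by
  refine card_le_equidistantEdges (A := {s(u, v)}) (by simpa using h) ?_
  simp only [mem_singleton, forall_eq]
  rw [(edgeDist_eq_zero hG).2 (Sym2.mem_mk_left u v),
    (edgeDist_eq_zero hG).2 (Sym2.mem_mk_right u v)]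

lemma two_mul_min_closerEdges_le_deficiency (hG : G.Connected) (h : G.Adj u v) :
    2 * (min (closerEdges G u v) (closerEdges G v u) : ℤ) ≤ deficiency G s(u, v) := by
  have := equidistantEdges_pos hG h
  rw [deficiency_eq_two_mul_min_add]
  omega

lemma deficiency_nonneg (hG : G.Connected) {e : Sym2 V} (he : e ∈ G.edgeSet) :
    0 ≤ deficiency G e := by
  induction e with | _ u v
  have := two_mul_min_closerEdges_le_deficiency hG (G.mem_edgeSet.1 he)
  omega

lemma sum_deficiency_le_totalDeficiency (hG : G.Connected) {K : Finset (Sym2 V)}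
    (hK : ∀ f ∈ K, f ∈ G.edgeSet) : ∑ f ∈ K, deficiency G f ≤ totalDeficiency G := by
  classical
  exact sum_le_sum_of_subset_of_nonneg (fun f hf => mem_edgeFinset.2 (hK f hf))
    fun f hf _ => deficiency_nonneg hG (mem_edgeFinset.1 hf)

lemma two_le_deficiency (hG : G.Connected) {x y : V} (h : G.Adj u v) (hx : G.Adj u x)
    (hxv : x ≠ v) (hy : G.Adj v y) (hyu : y ≠ u) : 2 ≤ deficiency G s(u, v) := by
  have hu := closerEdges_pos hG h.ne hx hxv
  have hv := closerEdges_pos hG h.ne' hy hyu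
  have := two_mul_min_closerEdges_le_deficiency hG h
  omega

lemma deficiency_eq_zero_of_pendant (hG : G.Connected) (h : G.Adj u v)
    (hv : ∀ y, G.Adj v y → y = u) : deficiency G s(u, v) = 0 := by
  classical
  have hcloser : #(G.edgeFinset.erase s(u, v)) ≤ closerEdges G u v := by
    refine card_le_closerEdges (fun f hf => mem_edgeFinset.1 (mem_of_mem_erase hf)) fun f hf => ?_
    induction f with | _ a b
    rw [mem_erase, mem_edgeFinset, mem_edgeSet] at hf
    have ha : a ≠ v := by
      rintro rfl
      exact hf.1 (by rw [hv b hf.2, Sym2.eq_swap])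
    have hb : b ≠ v := by
      rintro rfl
      exact hf.1 (by rw [hv a hf.2.symm])
    exact min_lt_min (dist_lt_dist_of_pendant hG hv ha) (dist_lt_dist_of_pendant hG hv hb)
  rw [card_erase_of_mem (mem_edgeFinset.2 h), card_edgeFinset_eq_ncard] at hcloser
  have hsum := closerEdges_add_closerEdges_add_equidistantEdges G u v
  have hpos := equidistantEdges_pos hG h
  rw [deficiency_eq_two_mul_min_add]
  omega

lemma IsTriangle.two_le_deficiency (hG : G.Connected) (h : IsTriangle G p q r) :
    2 ≤ deficiency G s(p, q) :=
  EdgeMostar.two_le_deficiency hG h.adj₁₂ h.adj₃₁.symm h.adj₂₃.ne' h.adj₂₃ h.adj₃₁.ne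

-- The three differences of transmissions around a triangle add up to twice the largest of them,
-- which is at most `m - 3`.
lemma IsTriangle.ncard_edgeSet_add_three_le (hG : G.Connected) (h : IsTriangle G p q r) :
    (G.edgeSet.ncard : ℤ) + 3 ≤
      deficiency G s(p, q) + deficiency G s(q, r) + deficiency G s(r, p) := by
  have hpq := h.two_le_deficiency hG
  have hqr := h.rotate.two_le_deficiency hG
  have hrp := h.rotate.rotate.two_le_deficiency hG
  simp only [deficiency_eq_sub_abs_transmission_sub, h.adj₁₂, h.adj₂₃, h.adj₃₁,
    abs_eq_max_neg] at *
  omega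

lemma IsQuadrangle.three_le_deficiency (hG : G.Connected) (h : IsQuadrangle G p q r s) :
    3 ≤ deficiency G s(p, q) := by
  have hp := closerEdges_pos hG h.adj₁₂.ne h.adj₄₁.symm h.ne₂₄.symm
  have hq := closerEdges_pos hG h.adj₁₂.ne' h.adj₂₃ h.ne₁₃.symm
  have hmid : 2 ≤ equidistantEdges G p q := by
    classical
    have hpf : p ∉ s(r, s) := by simp [h.ne₁₃, h.adj₄₁.ne']
    have hqf : q ∉ s(r, s) := by simp [h.adj₂₃.ne, h.ne₂₄]
    have hne : s(p, q) ≠ s(r, s) := fun he => hpf (he ▸ Sym2.mem_mk_left p q)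
    rw [← card_pair hne]
    refine card_le_equidistantEdges (by simp [h.adj₁₂, h.adj₃₄]) ?_
    simp only [mem_insert, mem_singleton, forall_eq_or_imp, forall_eq]
    constructor
    · rw [(edgeDist_eq_zero hG).2 (Sym2.mem_mk_left p q),
        (edgeDist_eq_zero hG).2 (Sym2.mem_mk_right p q)]
    · rw [edgeDist_eq_one hG (Sym2.mem_mk_right r s) h.adj₄₁ hpf,
        edgeDist_eq_one hG (Sym2.mem_mk_left r s) h.adj₂₃.symm hqf]
  rw [deficiency_eq_two_mul_min_add]
  omega

end Deficiency

section Cycles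

variable {V : Type*} {G : SimpleGraph V} {u v w p q r s : V}

/-- The edge `e` lies on a cycle of `G`. -/
def OnCycle (G : SimpleGraph V) (e : Sym2 V) : Prop :=
  ∃ (u : V) (c : G.Walk u u), c.IsCycle ∧ e ∈ c.edges

lemma OnCycle.mem_edgeSet {e : Sym2 V} (h : OnCycle G e) : e ∈ G.edgeSet := by
  obtain ⟨u, c, -, he⟩ := h
  exact c.edges_subset_edgeSet he

lemma OnCycle.adj (h : OnCycle G s(u, v)) : G.Adj u v := h.mem_edgeSet

lemma OnCycle.symm (h : OnCycle G s(u, v)) : OnCycle G s(v, u) := by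
  rwa [Sym2.eq_swap]

lemma OnCycle.not_isBridge {e : Sym2 V} (h : OnCycle G e) : ¬ G.IsBridge e := by
  obtain ⟨u, c, hc, he⟩ := h
  exact fun hb => hb.notMem_edges_of_isCycle hc he

lemma exists_mem_edges_of_isCycle {c : G.Walk u u} (hc : c.IsCycle) (hv : v ∈ c.support) :
    ∃ a b, a ≠ b ∧ s(v, a) ∈ c.edges ∧ s(v, b) ∈ c.edges := by
  classical
  have hr := hc.rotate hv
  refine ⟨_, _, hr.snd_ne_penultimate, ?_, ?_⟩ <;> rw [← (c.rotate_edges v hv).mem_iff]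
  · exact Walk.mk_start_snd_mem_edges hr.not_nil
  · rw [Sym2.eq_swap]
    exact Walk.mk_penultimate_end_mem_edges hr.not_nil

lemma OnCycle.exists_next (h : OnCycle G s(u, v)) : ∃ w, w ≠ u ∧ OnCycle G s(v, w) := by
  obtain ⟨x, c, hc, he⟩ := h
  obtain ⟨a, b, hab, ha, hb⟩ :=
    exists_mem_edges_of_isCycle hc (c.snd_mem_support_of_mem_edges he)
  by_cases hau : a = u
  · exact ⟨b, hau ▸ hab.symm, x, c, hc, hb⟩
  · exact ⟨a, hau, x, c, hc, ha⟩

lemma card_edges_toFinset [DecidableEq V] {c : G.Walk u u} (hc : c.IsCycle) :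
    #c.edges.toFinset = c.length := by
  rw [List.toFinset_card_of_nodup hc.isTrail.edges_nodup, Walk.length_edges]

/-- The closed walk around a triangle. -/
def IsTriangle.walk (h : IsTriangle G p q r) : G.Walk p p :=
  .cons h.adj₁₂ (.cons h.adj₂₃ (.cons h.adj₃₁ .nil))

/-- The closed walk around a 4-cycle. -/
def IsQuadrangle.walk (h : IsQuadrangle G p q r s) : G.Walk p p :=
  .cons h.adj₁₂ (.cons h.adj₂₃ (.cons h.adj₃₄ (.cons h.adj₄₁ .nil)))

lemma IsTriangle.isCycle_walk (h : IsTriangle G p q r) : h.walk.IsCycle := by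
  simp [IsTriangle.walk, Walk.cons_isCycle_iff, h.adj₁₂.ne, h.adj₁₂.ne', h.adj₂₃.ne, h.adj₃₁.ne,
    h.adj₃₁.ne']

lemma IsQuadrangle.isCycle_walk (h : IsQuadrangle G p q r s) : h.walk.IsCycle := by
  simp [IsQuadrangle.walk, Walk.cons_isCycle_iff, h.adj₁₂.ne, h.adj₁₂.ne', h.adj₂₃.ne, h.adj₃₄.ne,
    h.adj₄₁.ne, h.adj₄₁.ne', h.ne₁₃, h.ne₁₃.symm, h.ne₂₄]

lemma exists_isTriangle_rotate_eq [DecidableEq V] {c : G.Walk u u} (hl : c.length = 3)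
    (hp : p ∈ c.support) :
    ∃ (q r : V) (h : IsTriangle G p q r), c.rotate p hp = h.walk := by
  have hl' : (c.rotate p hp).length = 3 := by rw [Walk.length_rotate, hl]
  match c.rotate p hp, hl' with
  | .cons hpq (.cons hqr (.cons hrp .nil)), _ => exact ⟨_, _, ⟨hpq, hqr, hrp⟩, rfl⟩

lemma exists_isQuadrangle_rotate_eq [DecidableEq V] {c : G.Walk u u} (hc : c.IsCycle)
    (hl : c.length = 4) (hp : p ∈ c.support) :
    ∃ (q r s : V) (h : IsQuadrangle G p q r s), c.rotate p hp = h.walk := by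
  have hl' : (c.rotate p hp).length = 4 := by rw [Walk.length_rotate, hl]
  have hr := (hc.rotate hp).support_nodup
  match c.rotate p hp, hl', hr with
  | .cons hpq (.cons hqr (.cons hrs (.cons hsp .nil))), _, hr =>
    simp only [Walk.support_cons, Walk.support_nil, List.tail_cons, List.nodup_cons,
      List.mem_cons, List.not_mem_nil, not_or] at hr
    exact ⟨_, _, _, ⟨hpq, hqr, hrs, hsp, Ne.symm hr.2.1.2.1, hr.1.2.1⟩, rfl⟩

-- A chord cuts off a cycle together with each of the two arcs, so each arc has length at most one.
lemma mem_edges_of_length_eq_girth {c : G.Walk u u} (hc : c.IsCycle) (hg : c.length = G.girth)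
    (hp : p ∈ c.support) (hq : q ∈ c.support) (hpq : G.Adj p q) : s(p, q) ∈ c.edges := by
  classical
  rw [← (c.rotate_edges p hp).mem_iff]
  have hr := hc.rotate hp
  have hq' : q ∈ (c.rotate p hp).support := (c.mem_support_rotate_iff p hp).2 hq
  have hlen : (c.rotate p hp).length = G.girth := by rw [Walk.length_rotate, hg]
  generalize c.rotate p hp = d at *
  by_contra hnot
  rw [← d.take_spec hq', Walk.edges_append, List.mem_append, not_or] at hnot
  have hcyc : (Walk.cons hpq.symm (d.takeUntil q hq')).IsCycle :=
    (Walk.cons_isCycle_iff _ _).2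
      ⟨hr.isPath_takeUntil hq', fun h => hnot.1 (by rwa [Sym2.eq_swap])⟩
  have hgirth := girth_le_length hcyc
  have hsplit := congrArg Walk.length (d.take_spec hq')
  rw [Walk.length_append] at hsplit
  rw [Walk.length_cons] at hgirth
  match d.dropUntil q hq', hnot.2, hsplit with
  | .nil, _, _ => exact hpq.ne rfl
  | .cons h .nil, hn, _ => exact hn (List.mem_singleton.2 Sym2.eq_swap)
  | .cons _ (.cons _ _), _, hsplit =>
    simp only [Walk.length_cons] at hsplit
    omega

lemma not_isTriangle_of_three_lt_girth (hg : 3 < G.girth) (p q r : V) :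
    ¬ IsTriangle G p q r := fun h => (girth_le_length h.isCycle_walk).not_gt hg

lemma not_isQuadrangle_of_four_lt_girth (hg : 4 < G.girth) (p q r s : V) :
    ¬ IsQuadrangle G p q r s := fun h => (girth_le_length h.isCycle_walk).not_gt hg

variable [Fintype V]

lemma ncard_edgeSet_add_one_eq_card_of_isTree (hG : G.IsTree) :
    G.edgeSet.ncard + 1 = Fintype.card V := by
  classical
  rw [← card_edgeFinset_eq_ncard, hG.card_edgeFinset]

lemma exists_isCycle_length_eq_girth (hG : G.Connected)
    (hcard : Fintype.card V ≤ G.edgeSet.ncard) :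
    ∃ (u : V) (c : G.Walk u u), c.IsCycle ∧ c.length = G.girth := by
  have hcyc : ¬ G.IsAcyclic := fun hac => by
    have := ncard_edgeSet_add_one_eq_card_of_isTree ⟨hG, hac⟩
    omega
  obtain ⟨u, c, hc, hl⟩ := exists_girth_eq_length.2 hcyc
  exact ⟨u, c, hc, hl.symm⟩

-- Deleting an edge of `c` leaves a connected graph that is not a tree; none of its cycles is
-- contained in `c`, since it would be shorter than `c`.
lemma exists_onCycle_notMem_edges (hG : G.Connected) (hcard : Fintype.card V < G.edgeSet.ncard)
    {c : G.Walk u u} (hc : c.IsCycle) (hg : c.length = G.girth) :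
    ∃ e, OnCycle G e ∧ e ∉ c.edges := by
  classical
  have he : s(u, c.snd) ∈ c.edges := Walk.mk_start_snd_mem_edges hc.not_nil
  have hon : OnCycle G s(u, c.snd) := ⟨u, c, hc, he⟩
  obtain ⟨v, c', hc', -⟩ := exists_isCycle_length_eq_girth
    (hG.connected_delete_edge_of_not_isBridge hon.not_isBridge) (by
      rw [edgeSet_deleteEdges, Set.ncard_sdiff_singleton_of_mem hon.mem_edgeSet]
      omega)
  have hmap := hc'.mapLe (deleteEdges_le {s(u, c.snd)})
  have hnot : s(u, c.snd) ∉ c'.edges := fun h => by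
    simpa using c'.edges_subset_edgeSet h
  by_contra! hall
  have hsub : c'.edges.toFinset ⊆ c.edges.toFinset.erase s(u, c.snd) := fun f hf => by
    rw [List.mem_toFinset] at hf
    refine mem_erase.2 ⟨fun h => hnot (h ▸ hf), List.mem_toFinset.2 (hall f ⟨v, _, hmap, ?_⟩)⟩
    rwa [Walk.edges_mapLe_eq_edges]
  have hle := card_le_card hsub
  rw [card_edges_toFinset hc', card_erase_of_mem (List.mem_toFinset.2 he),
    card_edges_toFinset hc] at hle
  have hgirth := girth_le_length hmap
  rw [Walk.length_map] at hgirth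
  have := hc.three_le_length
  omega

lemma exists_onCycle_notMem_support (hG : G.Connected) (hcard : Fintype.card V < G.edgeSet.ncard)
    {c : G.Walk u u} (hc : c.IsCycle) (hg : c.length = G.girth) :
    ∃ x y, OnCycle G s(x, y) ∧ y ∉ c.support := by
  obtain ⟨e, he, hec⟩ := exists_onCycle_notMem_edges hG hcard hc hg
  induction e with | _ x y
  by_cases hx : x ∈ c.support
  · exact ⟨x, y, he, fun hy => hec (mem_edges_of_length_eq_girth hc hg hx hy he.adj)⟩
  · exact ⟨y, x, he.symm, hx⟩

end Cycles

section CycleDeficiency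

variable {V : Type*} [Fintype V] {G : SimpleGraph V} {u v w : V}

lemma two_le_closerEdges (hG : G.Connected) (h : OnCycle G s(u, v))
    (h3 : ∀ w, ¬ IsTriangle G u v w) (h4 : ∀ w z, ¬ IsQuadrangle G u v w z) :
    2 ≤ closerEdges G v u := by
  classical
  obtain ⟨w, hwu, hw⟩ := h.exists_next
  obtain ⟨z, hzv, hz⟩ := hw.exists_next
  have hzu : z ≠ u := fun hzu => h3 w ⟨h.adj, hw.adj, hzu ▸ hz.adj⟩
  have hdw : 1 < G.dist w u := hG.one_lt_dist_of_ne_of_not_adj hwu fun hwu =>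
    h3 w ⟨h.adj, hw.adj, hwu⟩
  have hdz : 1 < G.dist z u := hG.one_lt_dist_of_ne_of_not_adj hzu fun hzu =>
    h4 w z ⟨h.adj, hw.adj, hz.adj, hzu, hwu.symm, hzv.symm⟩
  have hne : s(v, w) ≠ s(w, z) := by simp [hw.adj.ne, hzv.symm]
  rw [← card_pair hne]
  refine card_le_closerEdges (by simp [hw.adj, hz.adj]) ?_
  simp only [mem_insert, mem_singleton, forall_eq_or_imp, forall_eq]
  refine ⟨edgeDist_lt_of_mem_of_notMem hG (Sym2.mem_mk_left v w)
    (by simp [h.adj.ne, hwu.symm]), ?_⟩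
  rw [edgeDist_eq_one hG (Sym2.mem_mk_left w z) hw.adj.symm (by simp [hw.adj.ne, hzv.symm])]
  exact lt_min hdw hdz

lemma four_le_deficiency (hG : G.Connected) (h : OnCycle G s(u, v))
    (h3 : ∀ w, ¬ IsTriangle G u v w) (h4 : ∀ w z, ¬ IsQuadrangle G u v w z) :
    4 ≤ deficiency G s(u, v) := by
  have hv := two_le_closerEdges hG h h3 h4
  have hu := two_le_closerEdges hG h.symm (fun w hw => h3 w hw.reverse.rotate)
    fun w z hw => h4 z w hw.reverse.rotate.rotate
  have := two_mul_min_closerEdges_le_deficiency hG h.adj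
  omega

-- Besides its at least five edges, a shortest cycle comes with two consecutive edges on another
-- cycle, and each of these seven edges costs four.
lemma twenty_eight_le_totalDeficiency (hG : G.Connected)
    (hcard : Fintype.card V < G.edgeSet.ncard) (hg : 5 ≤ G.girth) :
    28 ≤ totalDeficiency G := by
  classical
  obtain ⟨u, c, hc, hcg⟩ := exists_isCycle_length_eq_girth hG hcard.le
  obtain ⟨x, y, hxy, hy⟩ := exists_onCycle_notMem_support hG hcard hc hcg
  obtain ⟨z, hzx, hyz⟩ := hxy.exists_next
  have hxy_notMem : s(x, y) ∉ c.edges := fun h => hy (c.snd_mem_support_of_mem_edges h)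
  have hyz_notMem : s(y, z) ∉ c.edges := fun h => hy (c.fst_mem_support_of_mem_edges h)
  have hne : s(x, y) ≠ s(y, z) := by simp [hxy.adj.ne, hzx.symm]
  let K := insert s(x, y) (insert s(y, z) c.edges.toFinset)
  have hK : ∀ f ∈ K, OnCycle G f := by
    simp only [K, mem_insert, List.mem_toFinset, forall_eq_or_imp]
    exact ⟨hxy, hyz, fun f hf => ⟨u, c, hc, hf⟩⟩
  have hKcard : 7 ≤ #K := by
    rw [card_insert_of_notMem, card_insert_of_notMem, card_edges_toFinset hc]
    · omega
    · rwa [List.mem_toFinset]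
    · rw [mem_insert, List.mem_toFinset]
      exact not_or.2 ⟨hne, hxy_notMem⟩
  have hdef : ∀ f ∈ K, 4 ≤ deficiency G f := fun f hf => by
    induction f with | _ a b
    exact four_le_deficiency hG (hK _ hf)
      (not_isTriangle_of_three_lt_girth (by omega) a b)
      (not_isQuadrangle_of_four_lt_girth (by omega) a b)
  calc (28 : ℤ) ≤ #K * 4 := by omega
    _ = #K • 4 := (nsmul_eq_mul _ _).symm
    _ ≤ ∑ f ∈ K, deficiency G f := card_nsmul_le_sum K (deficiency G) 4 hdef
    _ ≤ totalDeficiency G :=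
      sum_deficiency_le_totalDeficiency hG fun f hf => (hK f hf).mem_edgeSet

lemma IsTriangle.sum_deficiency_walk (h : IsTriangle G u v w) [DecidableEq V] :
    ∑ f ∈ h.walk.edges.toFinset, deficiency G f =
      deficiency G s(u, v) + deficiency G s(v, w) + deficiency G s(w, u) := by
  rw [List.sum_toFinset _ h.isCycle_walk.isTrail.edges_nodup]
  simp [IsTriangle.walk, add_assoc]

lemma IsQuadrangle.sum_deficiency_walk {z : V} (h : IsQuadrangle G u v w z) [DecidableEq V] :
    ∑ f ∈ h.walk.edges.toFinset, deficiency G f =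
      deficiency G s(u, v) + deficiency G s(v, w) + deficiency G s(w, z) +
        deficiency G s(z, u) := by
  rw [List.sum_toFinset _ h.isCycle_walk.isTrail.edges_nodup]
  simp [IsQuadrangle.walk, add_assoc]

lemma ncard_edgeSet_add_three_le_sum_deficiency [DecidableEq V] (hG : G.Connected)
    {c : G.Walk u u} (hl : c.length = 3) :
    (G.edgeSet.ncard : ℤ) + 3 ≤ ∑ f ∈ c.edges.toFinset, deficiency G f := by
  obtain ⟨v, w, h, heq⟩ := exists_isTriangle_rotate_eq hl c.start_mem_support
  rw [← List.toFinset_eq_of_perm _ _ (c.rotate_edges u c.start_mem_support).perm, heq,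
    h.sum_deficiency_walk]
  exact h.ncard_edgeSet_add_three_le hG

lemma twelve_le_sum_deficiency [DecidableEq V] (hG : G.Connected) {c : G.Walk u u}
    (hc : c.IsCycle) (hl : c.length = 4) :
    12 ≤ ∑ f ∈ c.edges.toFinset, deficiency G f := by
  obtain ⟨v, w, z, h, heq⟩ := exists_isQuadrangle_rotate_eq hc hl c.start_mem_support
  rw [← List.toFinset_eq_of_perm _ _ (c.rotate_edges u c.start_mem_support).perm, heq,
    h.sum_deficiency_walk]
  linarith [h.three_le_deficiency hG, h.rotate.three_le_deficiency hG,
    h.rotate.rotate.three_le_deficiency hG, h.rotate.rotate.rotate.three_le_deficiency hG]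

lemma min_le_sum_deficiency [DecidableEq V] (hG : G.Connected) {c : G.Walk u u} (hc : c.IsCycle)
    (hl : c.length ≤ 4) :
    min 12 ((G.edgeSet.ncard : ℤ) + 3) ≤ ∑ f ∈ c.edges.toFinset, deficiency G f := by
  have := hc.three_le_length
  obtain h3 | h4 : c.length = 3 ∨ c.length = 4 := by omega
  · exact min_le_of_right_le (ncard_edgeSet_add_three_le_sum_deficiency hG h3)
  · exact min_le_of_left_le (twelve_le_sum_deficiency hG hc h4)

end CycleDeficiency

section Potentials

variable {V : Type*} {G : SimpleGraph V} {u v : V} {φ : V → ℕ}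

lemma le_add_length_of_forall_adj (hφ : ∀ ⦃x y⦄, G.Adj x y → φ x ≤ φ y + 1) (p : G.Walk u v) :
    φ u ≤ φ v + p.length := by
  induction p with
  | nil => simp
  | cons h p ih =>
    have := hφ h
    rw [Walk.length_cons]
    omega

lemma exists_walk_length_eq (hv : φ v = 0)
    (hφ : ∀ x, x ≠ v → ∃ y, G.Adj x y ∧ φ x = φ y + 1) (u : V) :
    ∃ p : G.Walk u v, p.length = φ u := by
  induction h : φ u generalizing u with
  | zero =>
    obtain rfl : u = v := by
      by_contra hne
      obtain ⟨y, -, hy⟩ := hφ u hne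
      omega
    exact ⟨.nil, rfl⟩
  | succ n ih =>
    obtain ⟨y, hadj, hy⟩ := hφ u (by rintro rfl; omega)
    obtain ⟨p, hp⟩ := ih y (by omega)
    exact ⟨.cons hadj p, by rw [Walk.length_cons, hp]⟩

lemma dist_eq_of_potential (hv : φ v = 0) (hlip : ∀ ⦃x y⦄, G.Adj x y → φ x ≤ φ y + 1)
    (hdesc : ∀ x, x ≠ v → ∃ y, G.Adj x y ∧ φ x = φ y + 1) (u : V) : G.dist u v = φ u := by
  obtain ⟨p, hp⟩ := exists_walk_length_eq hv hdesc u
  obtain ⟨q, hq⟩ := p.reachable.exists_walk_length_eq_dist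
  have := le_add_length_of_forall_adj hlip q
  have := dist_le p
  omega

lemma exists_adj_dist_eq (hG : G.Connected) (h : u ≠ v) :
    ∃ y, G.Adj u y ∧ G.dist u v = G.dist y v + 1 := by
  obtain ⟨p, hp⟩ := hG.exists_walk_length_eq_dist u v
  cases p with
  | nil => exact absurd rfl h
  | @cons _ y _ hadj p =>
    refine ⟨y, hadj, ?_⟩
    have hlip := hadj.diff_dist_adj (u := v)
    have := dist_le p
    rw [Walk.length_cons] at hp
    rw [G.dist_comm (u := v) (v := u), G.dist_comm (u := v) (v := y)] at hlip
    omega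

lemma exists_height (hG : G.Connected) {X : Set V} (hX : X.Nonempty) :
    ∃ h : V → ℕ, (∀ x, h x = 0 ↔ x ∈ X) ∧ ∀ x ∉ X, ∃ y, G.Adj x y ∧ h x = h y + 1 := by
  have : Nonempty X := hX.to_subtype
  let h : V → ℕ := fun x => ⨅ y : X, G.dist x y
  have hle (x : V) (y : X) : h x ≤ G.dist x y := ciInf_le (OrderBot.bddBelow _) y
  have hmem (x : V) : ∃ y : X, G.dist x y = h x := ciInf_mem fun y : X => G.dist x y
  refine ⟨h, fun x => ⟨fun hx => ?_, fun hx => ?_⟩, fun x hx => ?_⟩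
  · obtain ⟨y, hy⟩ := hmem x
    exact hG.dist_eq_zero_iff.1 (hy.trans hx) ▸ y.2
  · simpa using hle x ⟨x, hx⟩
  · obtain ⟨y, hy⟩ := hmem x
    obtain ⟨z, hxz, hz⟩ := exists_adj_dist_eq hG (u := x) (v := y) fun hxy => hx (hxy ▸ y.2)
    obtain ⟨y', hy'⟩ := hmem z
    have := hle z y
    have := hle x y'
    have := hxz.diff_dist_adj (u := (y' : V))
    refine ⟨z, hxz, ?_⟩
    simp only [G.dist_comm (u := (y' : V))] at this
    omega

end Potentials

section CoreDecomposition

variable {V W : Type*} {G : SimpleGraph V} {H : SimpleGraph W}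

/-- A decomposition of `G` into a copy of a core `H` and trees hanging from the copy. A vertex
outside the copy is joined to its parent, one step closer to the copy; the root of a vertex is the
core vertex whose tree contains it. -/
structure CoreDecomposition (H : SimpleGraph W) (G : SimpleGraph V) where
  copy : Copy H G
  height : V → ℕ
  parent : V → V
  root : V → W
  height_eq_zero : ∀ x, height x = 0 ↔ x ∈ Set.range copy
  adj_parent : ∀ x ∉ Set.range copy, G.Adj x (parent x)
  height_eq : ∀ x ∉ Set.range copy, height x = height (parent x) + 1
  root_copy : ∀ i, root (copy i) = i
  root_parent : ∀ x ∉ Set.range copy, root (parent x) = root x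
  edge_cases : ∀ e ∈ G.edgeSet,
    e ∈ Sym2.map copy '' H.edgeSet ∨ e ∈ (fun x => s(x, parent x)) '' (Set.range copy)ᶜ

section Existence

variable {f : Copy H G} {height : V → ℕ} {parent : V → V}

lemma exists_root (h0 : ∀ x, height x = 0 ↔ x ∈ Set.range f)
    (hparent : ∀ x ∉ Set.range f, height x = height (parent x) + 1) :
    ∃ root : V → W, (∀ i, root (f i) = i) ∧ ∀ x ∉ Set.range f, root (parent x) = root x := by
  have hit : ∀ n x, height x = n → parent^[n] x ∈ Set.range f := by
    intro n
    induction n with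
    | zero => exact fun x hx => (h0 x).1 hx
    | succ n ih =>
      intro x hx
      rw [Function.iterate_succ_apply]
      refine ih _ ?_
      have := hparent x fun hmem => by rw [(h0 x).2 hmem] at hx; omega
      omega
  choose root hroot using fun x => hit (height x) x rfl
  refine ⟨root, fun i => f.injective ?_, fun x hx => f.injective ?_⟩
  · rw [Copy.toHom_apply, hroot, (h0 (f i)).2 ⟨i, rfl⟩]
    rfl
  · rw [Copy.toHom_apply, hroot, Copy.toHom_apply, hroot, hparent x hx,
      Function.iterate_succ_apply]

lemma injOn_parentEdge (hparent : ∀ x ∉ Set.range f, height x = height (parent x) + 1) :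
    Set.InjOn (fun x => s(x, parent x)) (Set.range f)ᶜ := by
  intro x hx y hy hxy
  have hhx := hparent x hx
  have hhy := hparent y hy
  obtain ⟨h, -⟩ | ⟨h, h'⟩ := Sym2.eq_iff.1 hxy
  · exact h
  · rw [h'] at hhx
    rw [← h] at hhy
    omega

lemma disjoint_map_parentEdge (f : Copy H G) (parent : V → V) :
    Disjoint (Sym2.map f '' H.edgeSet) ((fun x => s(x, parent x)) '' (Set.range f)ᶜ) := by
  rw [Set.disjoint_left]
  rintro _ ⟨e, -, rfl⟩ ⟨x, hx, hxe⟩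
  have hmem : x ∈ Sym2.map f e := hxe ▸ Sym2.mem_mk_left x (parent x)
  obtain ⟨i, -, hi⟩ := Sym2.mem_map.1 hmem
  exact hx ⟨i, hi⟩

-- The edges of the copy and the edges to parents are distinct, and there are as many as `G` has.
lemma edge_cases_of_card [Fintype V] [Fintype W]
    (hadj : ∀ x ∉ Set.range f, G.Adj x (parent x))
    (hparent : ∀ x ∉ Set.range f, height x = height (parent x) + 1)
    (hcard : G.edgeSet.ncard + Fintype.card W = H.edgeSet.ncard + Fintype.card V) :
    ∀ e ∈ G.edgeSet,
      e ∈ Sym2.map f '' H.edgeSet ∨ e ∈ (fun x => s(x, parent x)) '' (Set.range f)ᶜ := by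
  have hf : Function.Injective f := f.injective
  have hsub : Sym2.map f '' H.edgeSet ∪ (fun x => s(x, parent x)) '' (Set.range f)ᶜ ⊆
      G.edgeSet := by
    rintro _ (⟨e, he, rfl⟩ | ⟨x, hx, rfl⟩)
    · exact f.toHom.map_mem_edgeSet he
    · exact hadj x hx
  have hrange : (Set.range f).ncard + (Set.range f)ᶜ.ncard = Fintype.card V := by
    rw [Set.ncard_add_ncard_compl, Nat.card_eq_fintype_card]
  have hW : (Set.range f).ncard = Fintype.card W := by
    rw [← Set.image_univ, Set.ncard_image_of_injective _ hf, Set.ncard_univ,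
      Nat.card_eq_fintype_card]
  have heq := Set.eq_of_subset_of_ncard_le hsub (by
    rw [Set.ncard_union_eq (disjoint_map_parentEdge f parent),
      Set.ncard_image_of_injective _ (Sym2.map.injective hf),
      (injOn_parentEdge hparent).ncard_image]
    omega)
  exact fun e he => heq.ge he

theorem exists_coreDecomposition [Fintype V] [Fintype W] [Nonempty W] (hG : G.Connected)
    (hcard : G.edgeSet.ncard + Fintype.card W = H.edgeSet.ncard + Fintype.card V)
    (f : Copy H G) : ∃ D : CoreDecomposition H G, D.copy = f := by
  obtain ⟨height, h0, hh⟩ := exists_height hG (Set.range_nonempty f)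
  choose! parent hadj hparent using hh
  obtain ⟨root, hroot, hroot'⟩ := exists_root h0 hparent
  exact ⟨⟨f, height, parent, root, h0, hadj, hparent, hroot, hroot',
    edge_cases_of_card hadj hparent hcard⟩, rfl⟩

end Existence

namespace CoreDecomposition

variable (D : CoreDecomposition H G) {x y : V}

lemma height_copy (i : W) : D.height (D.copy i) = 0 := (D.height_eq_zero _).2 ⟨i, rfl⟩

lemma dist_copy (hH : H.Connected) (x : V) (i : W) :
    G.dist x (D.copy i) = D.height x + H.dist (D.root x) i := by
  refine dist_eq_of_potential (φ := fun x => D.height x + H.dist (D.root x) i) ?_ ?_ ?_ x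
  · rw [D.height_copy, D.root_copy, dist_self]
  · intro x y hxy
    obtain ⟨e, he, hxy⟩ | ⟨z, hz, hxy⟩ := D.edge_cases s(x, y) hxy
    · induction e with | _ j l
      have := (H.mem_edgeSet.1 he).diff_dist_adj (u := i)
      simp only [H.dist_comm (u := i)] at this
      obtain ⟨rfl, rfl⟩ | ⟨rfl, rfl⟩ := Sym2.eq_iff.1 hxy <;>
      · simp only [D.height_copy, D.root_copy]
        omega
    · have := D.height_eq z hz
      have := D.root_parent z hz
      obtain ⟨rfl, rfl⟩ | ⟨rfl, rfl⟩ := Sym2.eq_iff.1 hxy <;>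
      · simp only [*]
        omega
  · intro x hx
    by_cases hmem : x ∈ Set.range D.copy
    · obtain ⟨j, rfl⟩ := hmem
      obtain ⟨l, hjl, hl⟩ := exists_adj_dist_eq hH fun h : j = i => hx (h ▸ rfl)
      refine ⟨D.copy l, D.copy.toHom.map_adj hjl, ?_⟩
      rw [D.height_copy, D.root_copy, D.height_copy, D.root_copy, hl]
      omega
    · refine ⟨D.parent x, D.adj_parent x hmem, ?_⟩
      rw [D.height_eq x hmem, D.root_parent x hmem]
      omega

lemma eq_parent_or (hx : x ∉ Set.range D.copy) (hxy : G.Adj x y) :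
    y = D.parent x ∨ y ∉ Set.range D.copy ∧ x = D.parent y := by
  obtain ⟨e, -, he⟩ | ⟨z, hz, he⟩ := D.edge_cases s(x, y) hxy
  · obtain ⟨i, -, hi⟩ := Sym2.mem_map.1 (he ▸ Sym2.mem_mk_left x y)
    exact absurd ⟨i, hi⟩ hx
  · obtain ⟨rfl, rfl⟩ | ⟨rfl, rfl⟩ := Sym2.eq_iff.1 he
    · exact .inl rfl
    · exact .inr ⟨hz, rfl⟩

lemma adj_copy_iff {i j : W} : G.Adj (D.copy i) (D.copy j) ↔ H.Adj i j := by
  refine ⟨fun h => ?_, D.copy.toHom.map_adj⟩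
  obtain ⟨e, he, heq⟩ | ⟨x, hx, heq⟩ := D.edge_cases s(D.copy i, D.copy j) h
  · have hinj : Function.Injective D.copy := D.copy.injective
    obtain rfl : e = s(i, j) := Sym2.map.injective hinj heq
    exact he
  · have hmem : x ∈ s(D.copy i, D.copy j) := heq ▸ Sym2.mem_mk_left x (D.parent x)
    obtain rfl | rfl := Sym2.mem_iff.1 hmem <;> exact absurd ⟨_, rfl⟩ hx

lemma edgeDist_map (hH : H.Connected) (e : Sym2 W) (i : W) :
    edgeDist G (e.map D.copy) (D.copy i) = edgeDist H e i := by
  induction e with | _ j l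
  rw [Sym2.map_mk, edgeDist_mk, edgeDist_mk, D.dist_copy hH, D.dist_copy hH, D.height_copy,
    D.height_copy, D.root_copy, D.root_copy, zero_add, zero_add]

lemma edgeDist_parentEdge (hH : H.Connected) (hx : x ∉ Set.range D.copy) (i : W) :
    edgeDist G s(x, D.parent x) (D.copy i) = D.height (D.parent x) + H.dist (D.root x) i := by
  rw [edgeDist_mk, D.dist_copy hH, D.dist_copy hH, D.height_eq x hx, D.root_parent x hx]
  omega

end CoreDecomposition

end CoreDecomposition

section WeightedDeficiency

variable {W : Type*} [Fintype W]

/-- The transmission of a core vertex in a graph with core `H`, up to a summand independent of that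
vertex, when trees with `w l` edges hang from each core vertex `l`. -/
noncomputable def weightedTransmission (H : SimpleGraph W) (w : W → ℕ) (v : W) : ℤ :=
  transmission H v + ∑ l, (w l : ℤ) * H.dist l v

/-- The contribution of an edge of the core `H` in a graph in which trees with `w l` edges hang
from each core vertex `l`. -/
noncomputable def weightedContribution (H : SimpleGraph W) (w : W → ℕ) (e : Sym2 W) : ℤ :=
  Sym2.lift ⟨fun u v => |weightedTransmission H w u - weightedTransmission H w v|,
    fun _ _ => abs_sub_comm _ _⟩ e

open Classical in
/-- The total deficiency of the edges of the core `H` in a graph in which trees with `w l` edges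
hang from each core vertex `l`. -/
noncomputable def weightedDeficiency (H : SimpleGraph W) (w : W → ℕ) : ℤ :=
  ∑ e ∈ H.edgeFinset, (H.edgeSet.ncard + ∑ l, (w l : ℤ) - 1 - weightedContribution H w e)

end WeightedDeficiency

namespace CoreDecomposition

variable {V W : Type*} [Fintype V] {G : SimpleGraph V} {H : SimpleGraph W}
  (D : CoreDecomposition H G) {x : V} {e : Sym2 W}

open Classical in
/-- The vertices outside the copy of the core. -/
noncomputable def outside : Finset V := {x | x ∉ Set.range D.copy}

open Classical in
/-- The number of vertices outside the core, or equivalently of edges, in the tree that hangs from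
the core vertex `l`. -/
noncomputable def weight (l : W) : ℕ := #{x ∈ D.outside | D.root x = l}

lemma mem_outside : x ∈ D.outside ↔ x ∉ Set.range D.copy := by simp [outside]

lemma coe_outside : (D.outside : Set V) = (Set.range D.copy)ᶜ := by
  ext x
  exact D.mem_outside

lemma sum_outside_comp_root [Fintype W] (g : W → ℤ) :
    ∑ x ∈ D.outside, g (D.root x) = ∑ l, (D.weight l : ℤ) * g l := by
  classical
  rw [← sum_fiberwise' D.outside D.root]
  simp only [sum_const, nsmul_eq_mul, weight]

lemma card_outside [Fintype W] : #D.outside = ∑ l, D.weight l := by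
  classical
  exact card_eq_sum_card_fiberwise fun _ _ => mem_coe.2 (mem_univ _)

lemma card_outside_add_card [Fintype W] : #D.outside + Fintype.card W = Fintype.card V := by
  classical
  have hrange : #(univ.image D.copy) = Fintype.card W := card_image_of_injective _ D.copy.injective
  rw [← hrange, ← card_compl_add_card (univ.image D.copy)]
  congr 2
  ext x
  simp [mem_outside]

lemma sum_edgeFinset [Fintype G.edgeSet] [Fintype H.edgeSet] (g : Sym2 V → ℤ) :
    ∑ e ∈ G.edgeFinset, g e =
      ∑ e ∈ H.edgeFinset, g (e.map D.copy) + ∑ x ∈ D.outside, g s(x, D.parent x) := by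
  classical
  have hinj : Function.Injective D.copy := D.copy.injective
  have hunion : G.edgeFinset =
      H.edgeFinset.image (Sym2.map D.copy) ∪ D.outside.image fun x => s(x, D.parent x) := by
    ext e
    simp only [mem_edgeFinset, mem_union, mem_image, mem_outside]
    refine ⟨D.edge_cases e, ?_⟩
    rintro (⟨e, he, rfl⟩ | ⟨x, hx, rfl⟩)
    · exact D.copy.toHom.map_mem_edgeSet he
    · exact D.adj_parent x hx
  have hdisj : Disjoint (H.edgeFinset.image (Sym2.map D.copy))
      (D.outside.image fun x => s(x, D.parent x)) := by
    rw [← disjoint_coe, coe_image, coe_image, coe_edgeFinset, coe_outside]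
    exact disjoint_map_parentEdge D.copy D.parent
  rw [hunion, sum_union hdisj, sum_image (Sym2.map.injective hinj).injOn, sum_image]
  rw [coe_outside]
  exact injOn_parentEdge D.height_eq

lemma ncard_edgeSet [Fintype W] : G.edgeSet.ncard = H.edgeSet.ncard + ∑ l, D.weight l := by
  classical
  have h := D.sum_edgeFinset fun _ => 1
  simp only [sum_const, card_edgeFinset_eq_ncard, D.card_outside, nsmul_one] at h
  exact_mod_cast h

lemma root_eq_of_weight_eq_zero {l₀ : W} (hw : ∀ l ≠ l₀, D.weight l = 0)
    (hx : x ∉ Set.range D.copy) : D.root x = l₀ := by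
  classical
  by_contra hne
  have := hw _ hne
  rw [weight, card_eq_zero, filter_eq_empty_iff] at this
  exact this (D.mem_outside.2 hx) rfl

variable [Fintype W]

lemma transmission_copy (hH : H.Connected) (i : W) :
    transmission G (D.copy i) =
      weightedTransmission H D.weight i + ∑ x ∈ D.outside, (D.height (D.parent x) : ℤ) := by
  classical
  have htrees : ∑ x ∈ D.outside, (edgeDist G s(x, D.parent x) (D.copy i) : ℤ) =
      ∑ x ∈ D.outside, (D.height (D.parent x) : ℤ) + ∑ l, (D.weight l : ℤ) * H.dist l i := by
    rw [← D.sum_outside_comp_root, ← sum_add_distrib]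
    refine sum_congr rfl fun x hx => ?_
    rw [D.edgeDist_parentEdge hH (D.mem_outside.1 hx), Nat.cast_add]
  rw [transmission, D.sum_edgeFinset, htrees, weightedTransmission, transmission]
  simp only [D.edgeDist_map hH]
  ring

lemma deficiency_map (hH : H.Connected) (he : e ∈ H.edgeSet) :
    deficiency G (e.map D.copy) =
      H.edgeSet.ncard + ∑ l, (D.weight l : ℤ) - 1 - weightedContribution H D.weight e := by
  induction e with | _ i j
  have hadj : G.Adj (D.copy i) (D.copy j) := D.copy.toHom.map_adj he
  rw [Sym2.map_mk, deficiency_eq_sub_abs_transmission_sub hadj, D.transmission_copy hH,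
    D.transmission_copy hH, add_sub_add_right_eq_sub, D.ncard_edgeSet]
  push_cast
  rfl

lemma totalDeficiency_eq (hH : H.Connected) :
    totalDeficiency G =
      weightedDeficiency H D.weight + ∑ x ∈ D.outside, deficiency G s(x, D.parent x) := by
  classical
  rw [totalDeficiency, D.sum_edgeFinset, weightedDeficiency]
  congr 1
  exact sum_congr rfl fun e he => D.deficiency_map hH (mem_edgeFinset.1 he)

lemma weightedDeficiency_le_totalDeficiency (hG : G.Connected) (hH : H.Connected) :
    weightedDeficiency H D.weight ≤ totalDeficiency G := by
  rw [D.totalDeficiency_eq hH]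
  exact le_add_of_nonneg_right (sum_nonneg fun x hx =>
    deficiency_nonneg hG (D.adj_parent x (D.mem_outside.1 hx)))

lemma deficiency_parentEdge_eq_zero (hG : G.Connected) (hH : H.Connected)
    (hle : totalDeficiency G ≤ weightedDeficiency H D.weight) (hx : x ∉ Set.range D.copy) :
    deficiency G s(x, D.parent x) = 0 := by
  rw [D.totalDeficiency_eq hH, add_le_iff_nonpos_right] at hle
  have hnonneg : ∀ x ∈ D.outside, 0 ≤ deficiency G s(x, D.parent x) := fun x hx =>
    deficiency_nonneg hG (D.adj_parent x (D.mem_outside.1 hx))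
  exact (sum_eq_zero_iff_of_nonneg hnonneg).1 (hle.antisymm (sum_nonneg hnonneg)) x
    (D.mem_outside.2 hx)

-- Otherwise the edge from the parent towards the core has a further edge at either end, so that
-- its deficiency is positive.
lemma parent_mem_range [Nontrivial W] (hG : G.Connected) (hH : H.Connected)
    (hle : totalDeficiency G ≤ weightedDeficiency H D.weight) (hx : x ∉ Set.range D.copy) :
    D.parent x ∈ Set.range D.copy := by
  by_contra hp
  have hxp := D.height_eq x hx
  have hpp := D.height_eq _ hp
  obtain ⟨z, hz, hzp⟩ : ∃ z, G.Adj (D.parent (D.parent x)) z ∧ z ≠ D.parent x := by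
    by_cases hmem : D.parent (D.parent x) ∈ Set.range D.copy
    · obtain ⟨i, hi⟩ := hmem
      obtain ⟨j, hj⟩ := hH.preconnected.exists_adj_of_nontrivial i
      exact ⟨D.copy j, hi ▸ D.copy.toHom.map_adj hj, fun h => hp ⟨j, h⟩⟩
    · refine ⟨_, D.adj_parent _ hmem, fun h => ?_⟩
      have := D.height_eq _ hmem
      rw [h] at this
      omega
  have htwo := two_le_deficiency hG (D.adj_parent _ hp) (D.adj_parent x hx).symm
    (fun h => by rw [← h] at hpp; omega) hz hzp
  rw [D.deficiency_parentEdge_eq_zero hG hH hle hp] at htwo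
  omega

lemma adj_iff_eq_copy [Nontrivial W] (hG : G.Connected) (hH : H.Connected)
    (hle : totalDeficiency G ≤ weightedDeficiency H D.weight) {l₀ : W}
    (hw : ∀ l ≠ l₀, D.weight l = 0) (hx : x ∉ Set.range D.copy) {y : V} :
    G.Adj x y ↔ y = D.copy l₀ := by
  have hparent {x : V} (hx : x ∉ Set.range D.copy) : D.parent x = D.copy l₀ := by
    obtain ⟨i, hi⟩ := D.parent_mem_range hG hH hle hx
    have hroot := D.root_parent x hx
    rw [← hi, D.root_copy, D.root_eq_of_weight_eq_zero hw hx] at hroot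
    rw [← hi, hroot]
  constructor
  · intro hxy
    obtain rfl | ⟨hy, rfl⟩ := D.eq_parent_or hx hxy
    · exact hparent hx
    · exact absurd ⟨_, (hparent hy).symm⟩ hx
  · rintro rfl
    exact hparent hx ▸ D.adj_parent x hx

end CoreDecomposition

section AttachPendants

variable {V W : Type*} {G : SimpleGraph V} {H : SimpleGraph W} {l₀ : W} {p : ℕ}

lemma Isom.trans_attachPendants (h : Isom G (attachPendants H l₀ p)) (σ : H ≃g H) :
    Isom G (attachPendants H (σ l₀) p) := by
  obtain ⟨e⟩ := h
  refine ⟨e.trans ⟨Equiv.sumCongr σ.toEquiv (Equiv.refl _), ?_⟩⟩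
  rintro (i | i) (j | j)
  · exact σ.map_adj_iff
  · exact σ.injective.eq_iff
  · exact σ.injective.eq_iff
  · exact Iff.rfl

lemma connected_attachPendants (hH : H.Connected) (l₀ : W) (p : ℕ) :
    (attachPendants H l₀ p).Connected := by
  let inl : H →g attachPendants H l₀ p := ⟨Sum.inl, id⟩
  rw [connected_iff_exists_forall_reachable]
  refine ⟨.inl l₀, ?_⟩
  rintro (i | i)
  · exact (hH l₀ i).map inl
  · exact Adj.reachable rfl

/-- The decomposition of `attachPendants H l₀ p` into `H` and its pendent edges. -/
def pendantDecomposition (H : SimpleGraph W) (l₀ : W) (p : ℕ) :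
    CoreDecomposition H (attachPendants H l₀ p) where
  copy := ⟨⟨Sum.inl, id⟩, Sum.inl_injective⟩
  height := Sum.elim 0 1
  parent := Sum.elim Sum.inl fun _ => Sum.inl l₀
  root := Sum.elim id fun _ => l₀
  height_eq_zero := by
    rintro (i | i)
    · exact iff_of_true rfl ⟨i, rfl⟩
    · exact iff_of_false one_ne_zero fun ⟨_, h⟩ => Sum.inl_ne_inr h
  adj_parent := by
    rintro (i | i) h
    · exact absurd ⟨i, rfl⟩ h
    · rfl
  height_eq := by
    rintro (i | i) h
    · exact absurd ⟨i, rfl⟩ h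
    · rfl
  root_copy _ := rfl
  root_parent := by
    rintro (i | i) h
    · exact absurd ⟨i, rfl⟩ h
    · rfl
  edge_cases e he := by
    have hinr (i : Fin p) :
        (Sum.inr i : W ⊕ Fin p) ∉ Set.range (⟨⟨Sum.inl, id⟩, Sum.inl_injective⟩ :
          Copy H (attachPendants H l₀ p)) := fun ⟨_, h⟩ => Sum.inl_ne_inr h
    induction e with | _ x y
    rcases x with i | i <;> rcases y with j | j
    · exact .inl ⟨s(i, j), he, rfl⟩
    · obtain rfl : i = l₀ := he
      exact .inr ⟨.inr j, hinr j, Sym2.eq_swap⟩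
    · obtain rfl : j = l₀ := he
      exact .inr ⟨.inr i, hinr i, rfl⟩
    · exact he.elim

end AttachPendants

section AttachPendantsFinite

variable {V W : Type*} [Fintype V] [Fintype W] {G : SimpleGraph V} {H : SimpleGraph W} {l₀ : W}
  {p : ℕ}

lemma isom_attachPendants (f : Copy H G) (hcard : Fintype.card V = Fintype.card W + p)
    (hadj : ∀ i j, G.Adj (f i) (f j) ↔ H.Adj i j)
    (hpendant : ∀ x ∉ Set.range f, ∀ y, G.Adj x y ↔ y = f l₀) :
    Isom G (attachPendants H l₀ p) := by
  classical
  have hf : Function.Injective f := f.injective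
  let e₁ : W ≃ Set.range f := Equiv.ofInjective f hf
  have hcompl : Fintype.card {x // x ∉ Set.range f} = p := by
    rw [Fintype.card_subtype_compl, Fintype.card_congr e₁.symm, hcard, Nat.add_sub_cancel_left]
  let e₂ : Fin p ≃ {x // x ∉ Set.range f} := (Fintype.equivFinOfCardEq hcompl).symm
  let e : W ⊕ Fin p ≃ V := (Equiv.sumCongr e₁ e₂).trans (Equiv.sumCompl (· ∈ Set.range f))
  have hinl (i : W) : e (.inl i) = f i := rfl
  have hinr (i : Fin p) : e (.inr i) ∉ Set.range f := (e₂ i).2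
  refine ⟨SimpleGraph.Iso.symm ⟨e, ?_⟩⟩
  rintro (i | i) (j | j)
  · exact hadj i j
  · rw [G.adj_comm, hpendant _ (hinr j), hinl, hf.eq_iff]
    rfl
  · rw [hpendant _ (hinr i), hinl, hf.eq_iff]
    rfl
  · rw [hpendant _ (hinr i)]
    exact iff_of_false (fun h => hinr j ⟨_, h.symm⟩) id

lemma CoreDecomposition.isom_attachPendants [Nontrivial W] (D : CoreDecomposition H G)
    (hG : G.Connected) (hH : H.Connected)
    (hle : totalDeficiency G ≤ weightedDeficiency H D.weight) (hw : ∀ l ≠ l₀, D.weight l = 0) :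
    Isom G (attachPendants H l₀ (∑ l, D.weight l)) := by
  refine EdgeMostar.isom_attachPendants D.copy ?_ (fun _ _ => D.adj_copy_iff)
    fun x hx y => D.adj_iff_eq_copy hG hH hle hw hx
  rw [← D.card_outside_add_card, D.card_outside, add_comm]

theorem IsBicyclic.exists_weight [Nontrivial W] {m : ℕ} (hG : IsBicyclic G m) (hH : H.Connected)
    (hcard : H.edgeSet.ncard = Fintype.card W + 1) (f : Copy H G) :
    ∃ w : W → ℕ, m = H.edgeSet.ncard + ∑ l, w l ∧ weightedDeficiency H w ≤ totalDeficiency G ∧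
      ∀ l₀, (∀ l ≠ l₀, w l = 0) → totalDeficiency G ≤ weightedDeficiency H w →
        Isom G (attachPendants H l₀ (m - H.edgeSet.ncard)) := by
  obtain ⟨hconn, hV, hm⟩ := hG
  obtain ⟨D, -⟩ := exists_coreDecomposition hconn (by omega) f
  have hsum := D.ncard_edgeSet
  refine ⟨D.weight, by omega, D.weightedDeficiency_le_totalDeficiency hconn hH,
    fun l₀ hw hle => ?_⟩
  rw [show m - H.edgeSet.ncard = ∑ l, D.weight l by omega]
  exact D.isom_attachPendants hconn hH hle hw

lemma outside_pendantDecomposition :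
    (pendantDecomposition H l₀ p).outside = univ.map .inr := by
  ext (i | i)
  · simpa [CoreDecomposition.mem_outside] using ⟨i, rfl⟩
  · rw [CoreDecomposition.mem_outside]
    exact iff_of_true (fun ⟨_, h⟩ => Sum.inl_ne_inr h) (mem_map_of_mem _ (mem_univ i))

open Classical in
lemma weight_pendantDecomposition :
    (pendantDecomposition H l₀ p).weight = Pi.single l₀ p := by
  ext l
  simp only [CoreDecomposition.weight, outside_pendantDecomposition, filter_map, card_map]
  obtain rfl | hl := eq_or_ne l l₀
  · rw [filter_true_of_mem (by exact fun _ _ => rfl), card_univ, Fintype.card_fin,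
      Pi.single_eq_same]
  · rw [filter_false_of_mem (by exact fun _ _ => hl.symm), card_empty, Pi.single_eq_of_ne hl]

lemma ncard_edgeSet_attachPendants {U : Type*} [Finite U] (H : SimpleGraph U) (l₀ : U) (p : ℕ) :
    (attachPendants H l₀ p).edgeSet.ncard = H.edgeSet.ncard + p := by
  classical
  have := Fintype.ofFinite U
  rw [(pendantDecomposition H l₀ p).ncard_edgeSet, weight_pendantDecomposition,
    Fintype.sum_pi_single']

lemma isBicyclic_attachPendants (hH : H.Connected)
    (hcard : H.edgeSet.ncard = Fintype.card W + 1) (l₀ : W) (p : ℕ) :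
    IsBicyclic (attachPendants H l₀ p) (H.edgeSet.ncard + p) := by
  refine ⟨connected_attachPendants hH l₀ p, ?_, ncard_edgeSet_attachPendants H l₀ p⟩
  rw [ncard_edgeSet_attachPendants, Fintype.card_sum, Fintype.card_fin]
  omega

open Classical in
lemma totalDeficiency_attachPendants (hH : H.Connected) (l₀ : W) (p : ℕ) :
    totalDeficiency (attachPendants H l₀ p) = weightedDeficiency H (Pi.single l₀ p) := by
  rw [(pendantDecomposition H l₀ p).totalDeficiency_eq hH, weight_pendantDecomposition,
    outside_pendantDecomposition, sum_map, sum_eq_zero, add_zero]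
  intro i _
  rw [Sym2.eq_swap]
  refine deficiency_eq_zero_of_pendant (connected_attachPendants hH l₀ p) rfl ?_
  rintro (j | j) h
  · exact congrArg Sum.inl h
  · exact h.elim

end AttachPendantsFinite

section Isomorphism

lemma ncard_edgeSet_eq_of_iso {V W : Type*} {G : SimpleGraph V} {H : SimpleGraph W}
    (e : G ≃g H) : G.edgeSet.ncard = H.edgeSet.ncard :=
  Set.ncard_congr' e.mapEdgeSet

variable {V W : Type*} [Fintype V] [Fintype W] {G : SimpleGraph V} {H : SimpleGraph W} {m : ℕ}

lemma IsBicyclic.of_iso (hG : IsBicyclic G m) (e : G ≃g H) : IsBicyclic H m := by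
  obtain ⟨hconn, hV, hm⟩ := hG
  rw [IsBicyclic, ← ncard_edgeSet_eq_of_iso e, ← Fintype.card_congr e.toEquiv]
  exact ⟨e.connected_iff.1 hconn, hV, hm⟩

lemma totalDeficiency_eq_weightedDeficiency_zero_of_iso (hG : G.Connected) (e : H ≃g G) :
    totalDeficiency G = weightedDeficiency H 0 := by
  have hH : H.Connected := e.connected_iff.2 hG
  have := hH.nonempty
  obtain ⟨D, -⟩ := exists_coreDecomposition hG (by
    rw [ncard_edgeSet_eq_of_iso e, Fintype.card_congr e.toEquiv]) e.toCopy
  have hcard := D.card_outside_add_card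
  rw [Fintype.card_congr e.toEquiv, Nat.add_eq_right, card_eq_zero] at hcard
  have hweight : D.weight = 0 := by
    ext l
    simp [CoreDecomposition.weight, hcard]
  rw [D.totalDeficiency_eq hH, hcard, hweight, sum_empty, add_zero]

lemma Isom.totalDeficiency_eq (hG : G.Connected) (h : Isom G H) :
    totalDeficiency G = totalDeficiency H := by
  obtain ⟨e⟩ := h
  rw [totalDeficiency_eq_weightedDeficiency_zero_of_iso hG e.symm,
    totalDeficiency_eq_weightedDeficiency_zero_of_iso (e.connected_iff.1 hG) Iso.refl]

end Isomorphism

section DistanceTable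

variable {V W : Type*} {G : SimpleGraph V} {H : SimpleGraph W} {n : ℕ}

/-- A list of the `n` edges of `H` together with a table of its distances. The table is certified
by conditions that can be decided by enumeration: distances change by at most one along an edge, and
every vertex has a neighbour that is closer to any given other vertex. -/
structure DistanceTable (H : SimpleGraph W) (n : ℕ) where
  edge : Fin n → W × W
  dist : W → W → ℕ
  adj_iff : ∀ i j, H.Adj i j ↔ ∃ t, s((edge t).1, (edge t).2) = s(i, j)
  injective : Function.Injective fun t => s((edge t).1, (edge t).2)
  dist_self : ∀ i, dist i i = 0
  lipschitz : ∀ t l, dist (edge t).1 l ≤ dist (edge t).2 l + 1 ∧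
    dist (edge t).2 l ≤ dist (edge t).1 l + 1
  exists_step : ∀ i l, i = l ∨ ∃ t,
    i = (edge t).1 ∧ dist i l = dist (edge t).2 l + 1 ∨
      i = (edge t).2 ∧ dist i l = dist (edge t).1 l + 1

namespace DistanceTable

lemma adj (T : DistanceTable H n) (t : Fin n) : H.Adj (T.edge t).1 (T.edge t).2 :=
  (T.adj_iff _ _).2 ⟨t, rfl⟩

lemma dist_le_add_one (T : DistanceTable H n) {i j : W} (h : H.Adj i j) (l : W) :
    T.dist i l ≤ T.dist j l + 1 := by
  obtain ⟨t, ht⟩ := (T.adj_iff i j).1 h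
  obtain ⟨rfl, rfl⟩ | ⟨rfl, rfl⟩ := Sym2.eq_iff.1 ht
  · exact (T.lipschitz t l).1
  · exact (T.lipschitz t l).2

lemma exists_adj_dist_eq (T : DistanceTable H n) {i l : W} (h : i ≠ l) :
    ∃ j, H.Adj i j ∧ T.dist i l = T.dist j l + 1 := by
  obtain ⟨t, ⟨rfl, ht⟩ | ⟨rfl, ht⟩⟩ := (T.exists_step i l).resolve_left h
  · exact ⟨_, T.adj t, ht⟩
  · exact ⟨_, (T.adj t).symm, ht⟩

lemma dist_eq (T : DistanceTable H n) (i l : W) : H.dist i l = T.dist i l :=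
  dist_eq_of_potential (φ := (T.dist · l)) (T.dist_self l) (fun _ _ h => T.dist_le_add_one h l)
    (fun _ h => T.exists_adj_dist_eq h) i

lemma connected (T : DistanceTable H n) [Nonempty W] : H.Connected where
  preconnected _ l :=
    (exists_walk_length_eq (φ := (T.dist · l)) (T.dist_self l) (fun _ h => T.exists_adj_dist_eq h)
      _).choose.reachable

lemma edgeSet_eq (T : DistanceTable H n) :
    H.edgeSet = Set.range fun t => s((T.edge t).1, (T.edge t).2) := by
  ext e
  induction e with | _ i j
  exact T.adj_iff i j

lemma ncard_edgeSet (T : DistanceTable H n) : H.edgeSet.ncard = n := by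
  rw [T.edgeSet_eq, ← Set.image_univ, Set.ncard_image_of_injective _ T.injective, Set.ncard_univ,
    Nat.card_eq_fintype_card, Fintype.card_fin]

lemma sum_edgeFinset (T : DistanceTable H n) [Fintype H.edgeSet] (g : Sym2 W → ℤ) :
    ∑ e ∈ H.edgeFinset, g e = ∑ t, g s((T.edge t).1, (T.edge t).2) := by
  classical
  have : H.edgeFinset = univ.image fun t => s((T.edge t).1, (T.edge t).2) := by
    rw [← coe_inj, coe_edgeFinset, T.edgeSet_eq, coe_image, coe_univ, Set.image_univ]
  rw [this, sum_image T.injective.injOn]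

/-- The copy of `H` in `G` on the vertices `f i`, provided that `G` contains all listed edges. -/
def copy (T : DistanceTable H n) (f : W → V) (hf : Function.Injective f)
    (hadj : ∀ t, G.Adj (f (T.edge t).1) (f (T.edge t).2)) : Copy H G where
  toHom.toFun := f
  toHom.map_rel' {i j} h := by
    obtain ⟨t, ht⟩ := (T.adj_iff i j).1 h
    obtain ⟨rfl, rfl⟩ | ⟨rfl, rfl⟩ := Sym2.eq_iff.1 ht
    · exact hadj t
    · exact (hadj t).symm
  injective' := hf

variable [Fintype W]

-- The coefficients `c` and `a` are parameters so that `decide` can compare them with the table.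
lemma weightedDeficiency_eq (T : DistanceTable H n) (c : Fin n → ℤ) (a : Fin n → W → ℤ)
    (hc : ∀ t, ∑ s, (((min (T.dist (T.edge s).1 (T.edge t).1) (T.dist (T.edge s).2 (T.edge t).1) :
      ℕ) : ℤ) - (min (T.dist (T.edge s).1 (T.edge t).2) (T.dist (T.edge s).2 (T.edge t).2) : ℕ)) =
        c t)
    (ha : ∀ t l, (T.dist l (T.edge t).1 : ℤ) - T.dist l (T.edge t).2 = a t l) (w : W → ℕ) :
    weightedDeficiency H w = n * (n - 1 + ∑ l, (w l : ℤ)) - ∑ t, |c t + ∑ l, a t l * w l| := by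
  classical
  have hgap (t : Fin n) :
      weightedContribution H w s((T.edge t).1, (T.edge t).2) = |c t + ∑ l, a t l * w l| := by
    change |weightedTransmission H w _ - weightedTransmission H w _| = _
    rw [weightedTransmission, weightedTransmission, add_sub_add_comm, transmission, transmission,
      T.sum_edgeFinset, T.sum_edgeFinset, ← Finset.sum_sub_distrib, ← Finset.sum_sub_distrib]
    simp only [edgeDist_mk, T.dist_eq, hc, ← mul_sub, ha, mul_comm (a t _)]
  rw [weightedDeficiency, T.sum_edgeFinset, T.ncard_edgeSet]
  simp only [hgap, Finset.sum_sub_distrib, sum_const, card_univ, Fintype.card_fin, nsmul_eq_mul]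
  ring

end DistanceTable

end DistanceTable

/-- The edges and distances of `diamond`. -/
def diamondTable : DistanceTable diamond 5 where
  edge := ![(1, 0), (2, 0), (2, 1), (3, 0), (3, 1)]
  dist := ![![0, 1, 1, 1], ![1, 0, 1, 1], ![1, 1, 0, 2], ![1, 1, 2, 0]]
  adj_iff := by
    simp only [diamond, fromEdgeSet_adj, Set.mem_insert_iff, Set.mem_singleton_iff]
    decide
  injective := by decide
  dist_self := by decide
  lipschitz := by decide
  exists_step := by decide

lemma weightedDeficiency_diamond (w : Fin 4 → ℕ) :
    weightedDeficiency diamond w = 5 * (4 + ∑ l, (w l : ℤ)) -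
      (|(w 0 - w 1 : ℤ)| + |(1 + w 0 - w 2 + w 3 : ℤ)| + |(1 + w 1 - w 2 + w 3 : ℤ)| +
        |(1 + w 0 + w 2 - w 3 : ℤ)| + |(1 + w 1 + w 2 - w 3 : ℤ)|) := by
  rw [diamondTable.weightedDeficiency_eq ![0, 1, 1, 1, 1]
    ![![1, -1, 0, 0], ![1, 0, -1, 1], ![0, 1, -1, 1], ![1, 0, 1, -1],
      ![0, 1, 1, -1]] (by decide) (by decide)]
  simp only [Fin.sum_univ_four, Fin.sum_univ_five, Matrix.cons_val]
  push_cast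
  ring_nf

/-- The edges and distances of `twoTriangles`. -/
def twoTrianglesTable : DistanceTable twoTriangles 6 where
  edge := ![(1, 0), (2, 1), (2, 0), (3, 0), (4, 3), (4, 0)]
  dist := ![![0, 1, 1, 1, 1], ![1, 0, 1, 2, 2], ![1, 1, 0, 2, 2], ![1, 2, 2, 0, 1],
      ![1, 2, 2, 1, 0]]
  adj_iff := by
    simp only [twoTriangles, fromEdgeSet_adj, Set.mem_insert_iff, Set.mem_singleton_iff]
    decide
  injective := by decide
  dist_self := by decide
  lipschitz := by decide
  exists_step := by decide

lemma weightedDeficiency_twoTriangles (w : Fin 5 → ℕ) :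
    weightedDeficiency twoTriangles w = 6 * (5 + ∑ l, (w l : ℤ)) -
      (|(3 + w 0 - w 1 + w 3 + w 4 : ℤ)| + |(w 1 - w 2 : ℤ)| +
        |(3 + w 0 - w 2 + w 3 + w 4 : ℤ)| + |(3 + w 0 + w 1 + w 2 - w 3 : ℤ)| +
        |(w 3 - w 4 : ℤ)| + |(3 + w 0 + w 1 + w 2 - w 4 : ℤ)|) := by
  rw [twoTrianglesTable.weightedDeficiency_eq ![3, 0, 3, 3, 0, 3]
    ![![1, -1, 0, 1, 1], ![0, 1, -1, 0, 0], ![1, 0, -1, 1, 1], ![1, 1, 1, -1, 0],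
      ![0, 0, 0, 1, -1], ![1, 1, 1, 0, -1]] (by decide) (by decide)]
  simp only [Fin.sum_univ_five, Fin.sum_univ_six, Matrix.cons_val]
  push_cast
  ring_nf

/-- The edges and distances of `squareTriangle`. -/
def squareTriangleTable : DistanceTable squareTriangle 7 where
  edge := ![(1, 0), (2, 1), (2, 3), (3, 0), (4, 0), (5, 4), (5, 0)]
  dist := ![![0, 1, 2, 1, 1, 1], ![1, 0, 1, 2, 2, 2], ![2, 1, 0, 1, 3, 3],
      ![1, 2, 1, 0, 2, 2], ![1, 2, 3, 2, 0, 1], ![1, 2, 3, 2, 1, 0]]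
  adj_iff := by
    simp only [squareTriangle, fromEdgeSet_adj, Set.mem_insert_iff, Set.mem_singleton_iff]
    decide
  injective := by decide
  dist_self := by decide
  lipschitz := by decide
  exists_step := by decide

lemma weightedDeficiency_squareTriangle (w : Fin 6 → ℕ) :
    weightedDeficiency squareTriangle w = 7 * (6 + ∑ l, (w l : ℤ)) -
      (2 * |(3 + w 0 - w 1 - w 2 + w 3 + w 4 + w 5 : ℤ)| +
        2 * |(3 + w 0 + w 1 - w 2 - w 3 + w 4 + w 5 : ℤ)| +
        |(4 + w 0 + w 1 + w 2 + w 3 - w 4 : ℤ)| + |(w 4 - w 5 : ℤ)| +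
        |(4 + w 0 + w 1 + w 2 + w 3 - w 5 : ℤ)|) := by
  rw [squareTriangleTable.weightedDeficiency_eq ![3, 3, 3, 3, 4, 0, 4]
    ![![1, -1, -1, 1, 1, 1], ![1, 1, -1, -1, 1, 1], ![1, -1, -1, 1, 1, 1],
      ![1, 1, -1, -1, 1, 1], ![1, 1, 1, 1, -1, 0], ![0, 0, 0, 0, 1, -1],
      ![1, 1, 1, 1, 0, -1]] (by decide) (by decide)]
  simp only [Fin.sum_univ_six, Fin.sum_univ_seven, Matrix.cons_val]
  push_cast
  ring_nf

/-- The edges and distances of `twoSquares`. -/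
def twoSquaresTable : DistanceTable twoSquares 8 where
  edge := ![(1, 0), (2, 1), (2, 3), (3, 0), (4, 0), (5, 4), (5, 6), (6, 0)]
  dist := ![![0, 1, 2, 1, 1, 2, 1], ![1, 0, 1, 2, 2, 3, 2], ![2, 1, 0, 1, 3, 4, 3],
      ![1, 2, 1, 0, 2, 3, 2], ![1, 2, 3, 2, 0, 1, 2], ![2, 3, 4, 3, 1, 0, 1],
      ![1, 2, 3, 2, 2, 1, 0]]
  adj_iff := by
    simp only [twoSquares, fromEdgeSet_adj, Set.mem_insert_iff, Set.mem_singleton_iff]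
    decide
  injective := by decide
  dist_self := by decide
  lipschitz := by decide
  exists_step := by decide

lemma weightedDeficiency_twoSquares (w : Fin 7 → ℕ) :
    weightedDeficiency twoSquares w = 8 * (7 + ∑ l, (w l : ℤ)) -
      (2 * |(4 + w 0 - w 1 - w 2 + w 3 + w 4 + w 5 + w 6 : ℤ)| +
        2 * |(4 + w 0 + w 1 - w 2 - w 3 + w 4 + w 5 + w 6 : ℤ)| +
        2 * |(4 + w 0 + w 1 + w 2 + w 3 - w 4 - w 5 + w 6 : ℤ)| +
        2 * |(4 + w 0 + w 1 + w 2 + w 3 + w 4 - w 5 - w 6 : ℤ)|) := by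
  rw [twoSquaresTable.weightedDeficiency_eq ![4, 4, 4, 4, 4, 4, 4, 4]
    ![![1, -1, -1, 1, 1, 1, 1], ![1, 1, -1, -1, 1, 1, 1], ![1, -1, -1, 1, 1, 1, 1],
      ![1, 1, -1, -1, 1, 1, 1], ![1, 1, 1, 1, -1, -1, 1], ![1, 1, 1, 1, 1, -1, -1],
      ![1, 1, 1, 1, -1, -1, 1], ![1, 1, 1, 1, 1, -1, -1]] (by decide) (by decide)]
  simp only [Fin.sum_univ_seven, Fin.sum_univ_eight, Matrix.cons_val]
  push_cast
  ring_nf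

/-- The edges and distances of `thetaTwo`. -/
def thetaTwoTable : DistanceTable thetaTwo 6 where
  edge := ![(2, 0), (2, 1), (3, 0), (3, 1), (4, 0), (4, 1)]
  dist := ![![0, 2, 1, 1, 1], ![2, 0, 1, 1, 1], ![1, 1, 0, 2, 2], ![1, 1, 2, 0, 2],
      ![1, 1, 2, 2, 0]]
  adj_iff := by
    simp only [thetaTwo, fromEdgeSet_adj, Set.mem_insert_iff, Set.mem_singleton_iff]
    decide
  injective := by decide
  dist_self := by decide
  lipschitz := by decide
  exists_step := by decide

lemma weightedDeficiency_thetaTwo (w : Fin 5 → ℕ) :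
    weightedDeficiency thetaTwo w = 6 * (5 + ∑ l, (w l : ℤ)) -
      (|(1 + w 0 - w 1 - w 2 + w 3 + w 4 : ℤ)| + |(1 - w 0 + w 1 - w 2 + w 3 + w 4 : ℤ)| +
        |(1 + w 0 - w 1 + w 2 - w 3 + w 4 : ℤ)| + |(1 - w 0 + w 1 + w 2 - w 3 + w 4 : ℤ)| +
        |(1 + w 0 - w 1 + w 2 + w 3 - w 4 : ℤ)| + |(1 - w 0 + w 1 + w 2 + w 3 - w 4 : ℤ)|) := by
  rw [thetaTwoTable.weightedDeficiency_eq ![1, 1, 1, 1, 1, 1]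
    ![![1, -1, -1, 1, 1], ![-1, 1, -1, 1, 1], ![1, -1, 1, -1, 1], ![-1, 1, 1, -1, 1],
      ![1, -1, 1, 1, -1], ![-1, 1, 1, 1, -1]] (by decide) (by decide)]
  simp only [Fin.sum_univ_five, Fin.sum_univ_six, Matrix.cons_val]
  push_cast
  ring_nf

/-- The graph `Θ(1,2,3)`: a triangle and a 4-cycle sharing the edge `01`. -/
def house : SimpleGraph (Fin 5) :=
  SimpleGraph.fromEdgeSet {s(0, 1), s(1, 2), s(2, 0), s(0, 3), s(3, 4), s(4, 1)}

/-- The edges and distances of `house`. -/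
def houseTable : DistanceTable house 6 where
  edge := ![(1, 0), (2, 1), (2, 0), (3, 0), (4, 3), (4, 1)]
  dist := ![![0, 1, 1, 1, 2], ![1, 0, 1, 2, 1], ![1, 1, 0, 2, 2], ![1, 2, 2, 0, 1],
      ![2, 1, 2, 1, 0]]
  adj_iff := by
    simp only [house, fromEdgeSet_adj, Set.mem_insert_iff, Set.mem_singleton_iff]
    decide
  injective := by decide
  dist_self := by decide
  lipschitz := by decide
  exists_step := by decide

lemma weightedDeficiency_house (w : Fin 5 → ℕ) :
    weightedDeficiency house w = 6 * (5 + ∑ l, (w l : ℤ)) -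
      (2 * |(w 0 - w 1 + w 3 - w 4 : ℤ)| + |(2 + w 1 - w 2 + w 4 : ℤ)| +
        |(2 + w 0 - w 2 + w 3 : ℤ)| + 2 * |(2 + w 0 + w 1 + w 2 - w 3 - w 4 : ℤ)|) := by
  rw [houseTable.weightedDeficiency_eq ![0, 2, 2, 2, 0, 2]
    ![![1, -1, 0, 1, -1], ![0, 1, -1, 0, 1], ![1, 0, -1, 1, 0], ![1, 1, 1, -1, -1],
      ![1, -1, 0, 1, -1], ![1, 1, 1, -1, -1]] (by decide) (by decide)]
  simp only [Fin.sum_univ_five, Fin.sum_univ_six, Matrix.cons_val]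
  push_cast
  ring_nf

/-- The graph `Θ(1,3,3)`: two 4-cycles sharing the edge `01`. -/
def domino : SimpleGraph (Fin 6) :=
  SimpleGraph.fromEdgeSet {s(0, 1), s(1, 2), s(2, 3), s(3, 0), s(0, 4), s(4, 5), s(5, 1)}

/-- The edges and distances of `domino`. -/
def dominoTable : DistanceTable domino 7 where
  edge := ![(1, 0), (2, 1), (2, 3), (3, 0), (4, 0), (5, 4), (5, 1)]
  dist := ![![0, 1, 2, 1, 1, 2], ![1, 0, 1, 2, 2, 1], ![2, 1, 0, 1, 3, 2],
      ![1, 2, 1, 0, 2, 3], ![1, 2, 3, 2, 0, 1], ![2, 1, 2, 3, 1, 0]]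
  adj_iff := by
    simp only [domino, fromEdgeSet_adj, Set.mem_insert_iff, Set.mem_singleton_iff]
    decide
  injective := by decide
  dist_self := by decide
  lipschitz := by decide
  exists_step := by decide

lemma weightedDeficiency_domino (w : Fin 6 → ℕ) :
    weightedDeficiency domino w = 7 * (6 + ∑ l, (w l : ℤ)) -
      (3 * |(w 0 - w 1 - w 2 + w 3 + w 4 - w 5 : ℤ)| +
        2 * |(3 + w 0 + w 1 - w 2 - w 3 + w 4 + w 5 : ℤ)| +
        2 * |(3 + w 0 + w 1 + w 2 + w 3 - w 4 - w 5 : ℤ)|) := by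
  rw [dominoTable.weightedDeficiency_eq ![0, 3, 0, 3, 3, 0, 3]
    ![![1, -1, -1, 1, 1, -1], ![1, 1, -1, -1, 1, 1], ![1, -1, -1, 1, 1, -1],
      ![1, 1, -1, -1, 1, 1], ![1, 1, 1, 1, -1, -1], ![1, -1, -1, 1, 1, -1],
      ![1, 1, 1, 1, -1, -1]] (by decide) (by decide)]
  simp only [Fin.sum_univ_six, Fin.sum_univ_seven, Matrix.cons_val]
  push_cast
  ring_nf

/-- The graph `Θ(2,2,3)`: a 4-cycle with a path of length 3 between its
opposite vertices `0, 2`. -/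
def thetaTwoTwoThree : SimpleGraph (Fin 6) :=
  SimpleGraph.fromEdgeSet {s(0, 1), s(1, 2), s(2, 3), s(3, 0), s(0, 4), s(4, 5), s(5, 2)}

/-- The edges and distances of `thetaTwoTwoThree`. -/
def thetaTwoTwoThreeTable : DistanceTable thetaTwoTwoThree 7 where
  edge := ![(1, 0), (1, 2), (3, 2), (3, 0), (4, 0), (5, 4), (5, 2)]
  dist := ![![0, 1, 2, 1, 1, 2], ![1, 0, 1, 2, 2, 2], ![2, 1, 0, 1, 2, 1],
      ![1, 2, 1, 0, 2, 2], ![1, 2, 2, 2, 0, 1], ![2, 2, 1, 2, 1, 0]]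
  adj_iff := by
    simp only [thetaTwoTwoThree, fromEdgeSet_adj, Set.mem_insert_iff, Set.mem_singleton_iff]
    decide
  injective := by decide
  dist_self := by decide
  lipschitz := by decide
  exists_step := by decide

lemma weightedDeficiency_thetaTwoTwoThree (w : Fin 6 → ℕ) :
    weightedDeficiency thetaTwoTwoThree w = 7 * (6 + ∑ l, (w l : ℤ)) -
      (|(1 + w 0 - w 1 - w 2 + w 3 + w 4 : ℤ)| + |(1 - w 0 - w 1 + w 2 + w 3 + w 5 : ℤ)| +
        |(1 - w 0 + w 1 + w 2 - w 3 + w 5 : ℤ)| + |(1 + w 0 + w 1 - w 2 - w 3 + w 4 : ℤ)| +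
        |(2 + w 0 + w 1 + w 3 - w 4 - w 5 : ℤ)| + |(w 0 - w 2 + w 4 - w 5 : ℤ)| +
        |(2 + w 1 + w 2 + w 3 - w 4 - w 5 : ℤ)|) := by
  rw [thetaTwoTwoThreeTable.weightedDeficiency_eq ![1, 1, 1, 1, 2, 0, 2]
    ![![1, -1, -1, 1, 1, 0], ![-1, -1, 1, 1, 0, 1], ![-1, 1, 1, -1, 0, 1],
      ![1, 1, -1, -1, 1, 0], ![1, 1, 0, 1, -1, -1], ![1, 0, -1, 0, 1, -1],
      ![0, 1, 1, 1, -1, -1]] (by decide) (by decide)]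
  simp only [Fin.sum_univ_six, Fin.sum_univ_seven, Matrix.cons_val]
  push_cast
  ring_nf

section WeightedCores

variable {m : ℕ}

lemma eq_zero_of_weightedDeficiency_twoSquares_le {w : Fin 7 → ℕ}
    (h : weightedDeficiency twoSquares w ≤ 24) :
    (∀ l ≠ 0, w l = 0) ∧ 24 ≤ weightedDeficiency twoSquares w := by
  simp only [weightedDeficiency_twoSquares, abs_eq_max_neg, Fin.sum_univ_seven] at *
  refine ⟨fun l hl ↦ ?_, by omega⟩
  fin_cases l <;> simp at hl ⊢ <;> omega

lemma eq_zero_of_weightedDeficiency_squareTriangle_le {w : Fin 6 → ℕ} (hm : m = 7 + ∑ l, w l)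
    (h : weightedDeficiency squareTriangle w ≤ min 24 (2 * (m : ℤ) + 6)) :
    (∀ l ≠ 0, w l = 0) ∧ min 24 (2 * (m : ℤ) + 6) ≤ weightedDeficiency squareTriangle w := by
  simp only [weightedDeficiency_squareTriangle, abs_eq_max_neg, Fin.sum_univ_six] at *
  refine ⟨fun l hl ↦ ?_, by omega⟩
  fin_cases l <;> simp at hl ⊢ <;> omega

lemma eq_zero_of_weightedDeficiency_twoTriangles_le {w : Fin 5 → ℕ} (hm : m = 6 + ∑ l, w l)
    (h : weightedDeficiency twoTriangles w ≤ min 24 (2 * (m : ℤ) + 6)) :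
    (∀ l ≠ 0, w l = 0) ∧ min 24 (2 * (m : ℤ) + 6) ≤ weightedDeficiency twoTriangles w := by
  simp only [weightedDeficiency_twoTriangles, abs_eq_max_neg, Fin.sum_univ_five] at *
  refine ⟨fun l hl ↦ ?_, by omega⟩
  fin_cases l <;> simp at hl ⊢ <;> omega

lemma exists_eq_zero_of_weightedDeficiency_diamond_le {w : Fin 4 → ℕ} (hm : m = 5 + ∑ l, w l)
    (h : weightedDeficiency diamond w ≤ min 24 (2 * (m : ℤ) + 6)) :
    ∃ l₀, (∀ l ≠ l₀, w l = 0) ∧ min 24 (2 * (m : ℤ) + 6) ≤ weightedDeficiency diamond w := by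
  have hpair (a : ℕ) : |(1 + a - w 2 + w 3 : ℤ)| + |(1 + a + w 2 - w 3 : ℤ)| =
      2 * max (1 + a : ℤ) (max (w 2 - w 3) (w 3 - w 2)) := by
    simp only [abs_eq_max_neg]
    omega
  have hpair₀ := hpair (w 0)
  have hpair₁ := hpair (w 1)
  have hchord : |(w 0 - w 1 : ℤ)| = max (w 0 - w 1 : ℤ) (-(w 0 - w 1)) := abs_eq_max_neg
  simp only [weightedDeficiency_diamond, Fin.sum_univ_four] at *
  have h01 : w 0 = 0 ∨ w 1 = 0 := by omega
  have h23 : w 2 = 0 ∨ w 3 = 0 := by omega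
  have hor : (w 0 = 0 ∧ w 1 = 0) ∨ (w 2 = 0 ∧ w 3 = 0) := by omega
  have hsupp : ∃ l₀, ∀ l ≠ l₀, w l = 0 := by
    rcases hor with ⟨h0, h1⟩ | ⟨h2, h3⟩
    · rcases h23 with h2 | h3
      exacts [⟨3, by simp [Fin.forall_fin_succ, h0, h1, h2]⟩,
        ⟨2, by simp [Fin.forall_fin_succ, h0, h1, h3]⟩]
    · rcases h01 with h0 | h1
      exacts [⟨1, by simp [Fin.forall_fin_succ, h0, h2, h3]⟩,
        ⟨0, by simp [Fin.forall_fin_succ, h1, h2, h3]⟩]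
  exact hsupp.imp fun l₀ h₀ ↦ ⟨h₀, by omega⟩

lemma lt_weightedDeficiency_thetaTwo {w : Fin 5 → ℕ} (hm : m = 6 + ∑ l, w l) :
    min 24 (2 * (m : ℤ) + 6) < weightedDeficiency thetaTwo w := by
  simp only [weightedDeficiency_thetaTwo, abs_eq_max_neg, Fin.sum_univ_five] at *
  omega

lemma lt_weightedDeficiency_house {w : Fin 5 → ℕ} (hm : m = 6 + ∑ l, w l) :
    min 24 (2 * (m : ℤ) + 6) < weightedDeficiency house w := by
  simp only [weightedDeficiency_house, abs_eq_max_neg, Fin.sum_univ_five] at *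
  omega

lemma lt_weightedDeficiency_domino (w : Fin 6 → ℕ) : 24 < weightedDeficiency domino w := by
  simp only [weightedDeficiency_domino, abs_eq_max_neg, Fin.sum_univ_six]
  omega

lemma lt_weightedDeficiency_thetaTwoTwoThree (w : Fin 6 → ℕ) :
    24 < weightedDeficiency thetaTwoTwoThree w := by
  have hsum : ∑ l, (w l : ℤ) = w 0 + w 1 + w 2 + w 3 + w 4 + w 5 := Fin.sum_univ_six _
  have hedge {x : ℤ} (h : -(2 + ∑ l, (w l : ℤ)) ≤ x ∧ x ≤ 2 + ∑ l, (w l : ℤ)) :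
      |x| ≤ 2 + ∑ l, (w l : ℤ) := abs_le.2 h
  have h₀ := hedge (x := 1 + w 0 - w 1 - w 2 + w 3 + w 4) (by omega)
  have h₁ := hedge (x := 1 - w 0 - w 1 + w 2 + w 3 + w 5) (by omega)
  have h₂ := hedge (x := 1 - w 0 + w 1 + w 2 - w 3 + w 5) (by omega)
  have h₃ := hedge (x := 1 + w 0 + w 1 - w 2 - w 3 + w 4) (by omega)
  have h₄ := hedge (x := 2 + w 0 + w 1 + w 3 - w 4 - w 5) (by omega)
  have h₅ := hedge (x := w 0 - w 2 + w 4 - w 5) (by omega)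
  have h₆ := hedge (x := 2 + w 1 + w 2 + w 3 - w 4 - w 5) (by omega)
  rw [weightedDeficiency_thetaTwoTwoThree]
  linarith

end WeightedCores

section ExtremalValues

variable {m : ℕ}

lemma totalDeficiency_B (m : ℕ) : totalDeficiency (B m) = 24 := by
  rw [B, totalDeficiency_attachPendants twoSquaresTable.connected, weightedDeficiency_twoSquares]
  simp only [Fin.sum_univ_seven, Pi.single_apply, Fin.isValue, Fin.reduceEq, ↓reduceIte,
    abs_eq_max_neg]
  omega

lemma totalDeficiency_B1 (hm : 7 ≤ m) : totalDeficiency (B1 m) = m + 15 := by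
  rw [B1, totalDeficiency_attachPendants squareTriangleTable.connected,
    weightedDeficiency_squareTriangle]
  simp only [Fin.sum_univ_six, Pi.single_apply, Fin.isValue, Fin.reduceEq, ↓reduceIte,
    abs_eq_max_neg]
  omega

lemma totalDeficiency_B2 (hm : 6 ≤ m) : totalDeficiency (B2 m) = 2 * m + 6 := by
  rw [B2, totalDeficiency_attachPendants twoTrianglesTable.connected,
    weightedDeficiency_twoTriangles]
  simp only [Fin.sum_univ_five, Pi.single_apply, Fin.isValue, Fin.reduceEq, ↓reduceIte,
    abs_eq_max_neg]
  omega

lemma totalDeficiency_B3 (hm : 5 ≤ m) : totalDeficiency (B3 m) = 2 * m + 6 := by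
  rw [B3, totalDeficiency_attachPendants diamondTable.connected, weightedDeficiency_diamond]
  simp only [Fin.sum_univ_four, Pi.single_apply, Fin.isValue, Fin.reduceEq, ↓reduceIte,
    abs_eq_max_neg]
  omega

lemma totalDeficiency_B4_five : totalDeficiency (B4 5) = 16 := by
  rw [B4, totalDeficiency_attachPendants diamondTable.connected, weightedDeficiency_diamond]
  simp [Pi.single_apply]

lemma totalDeficiency_B4 (hm : 6 ≤ m) : totalDeficiency (B4 m) = m + 15 := by
  rw [B4, totalDeficiency_attachPendants diamondTable.connected, weightedDeficiency_diamond]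
  simp only [Fin.sum_univ_four, Pi.single_apply, Fin.isValue, Fin.reduceEq, ↓reduceIte,
    abs_eq_max_neg]
  omega

end ExtremalValues

section Recognition

/-- The automorphism of the diamond that exchanges `0` with `1` and `2` with `3`: by symmetry, only
two vertices have to be considered for the attachment of pendent edges. -/
def diamondFlip : diamond ≃g diamond where
  toEquiv := (Equiv.swap 0 1).trans (Equiv.swap 2 3)
  map_rel_iff' := by
    intro i j
    rw [diamondTable.adj_iff, diamondTable.adj_iff]
    revert i j
    decide

lemma Isom.attachPendants_diamond {V : Type*} {G : SimpleGraph V} {m : ℕ} {l₀ : Fin 4}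
    (h : Isom G (attachPendants diamond l₀ (m - 5))) : Isom G (B3 m) ∨ Isom G (B4 m) := by
  fin_cases l₀
  · exact .inl h
  · exact .inl (h.trans_attachPendants diamondFlip)
  · exact .inr h
  · exact .inr (h.trans_attachPendants diamondFlip)

variable {V : Type*} [Fintype V] {G : SimpleGraph V} {m : ℕ} {a b c d x y z : V}

lemma IsBicyclic.exists_isom_attachPendants {W : Type*} [Fintype W] [Nontrivial W]
    {H : SimpleGraph W} (hG : IsBicyclic G m) (hH : H.Connected)
    (hcard : H.edgeSet.ncard = Fintype.card W + 1) (f : Copy H G) {D : ℤ}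
    (hD : totalDeficiency G ≤ D) {S : Set W}
    (hS : ∀ w : W → ℕ, m = H.edgeSet.ncard + ∑ l, w l → weightedDeficiency H w ≤ D →
      ∃ l₀ ∈ S, (∀ l ≠ l₀, w l = 0) ∧ D ≤ weightedDeficiency H w) :
    ∃ l₀ ∈ S, Isom G (attachPendants H l₀ (m - H.edgeSet.ncard)) := by
  obtain ⟨w, hm, hle, hisom⟩ := hG.exists_weight hH hcard f
  obtain ⟨l₀, hl₀, hw, hge⟩ := hS w hm (hle.trans hD)
  exact ⟨l₀, hl₀, hisom l₀ hw (hD.trans hge)⟩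

lemma IsBicyclic.isom_B (hG : IsBicyclic G m) (h : IsQuadrangle G a b c d)
    (h' : IsQuadrangle G a x y z) (hn : [a, b, c, d, x, y, z].Nodup)
    (hD : totalDeficiency G ≤ 24) : Isom G (B m) := by
  have f := twoSquaresTable.copy (G := G) ![a, b, c, d, x, y, z]
    (List.nodup_ofFn.1 (by simpa using hn)) (by
      intro t
      fin_cases t
      exacts [h.adj₁₂.symm, h.adj₂₃.symm, h.adj₃₄, h.adj₄₁, h'.adj₁₂.symm, h'.adj₂₃.symm, h'.adj₃₄,
        h'.adj₄₁])
  obtain ⟨l₀, rfl, hl₀⟩ := hG.exists_isom_attachPendants (S := {0}) twoSquaresTable.connected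
    twoSquaresTable.ncard_edgeSet f hD
    fun w _ hw => ⟨0, rfl, eq_zero_of_weightedDeficiency_twoSquares_le hw⟩
  rwa [twoSquaresTable.ncard_edgeSet] at hl₀

lemma IsBicyclic.isom_B1 (hG : IsBicyclic G m) (h : IsQuadrangle G a b c d)
    (h' : IsTriangle G a x y) (hn : [a, b, c, d, x, y].Nodup)
    (hD : totalDeficiency G ≤ min 24 (2 * (m : ℤ) + 6)) : Isom G (B1 m) := by
  have f := squareTriangleTable.copy (G := G) ![a, b, c, d, x, y]
    (List.nodup_ofFn.1 (by simpa using hn)) (by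
      intro t
      fin_cases t
      exacts [h.adj₁₂.symm, h.adj₂₃.symm, h.adj₃₄, h.adj₄₁, h'.adj₁₂.symm, h'.adj₂₃.symm, h'.adj₃₁])
  obtain ⟨l₀, rfl, hl₀⟩ := hG.exists_isom_attachPendants (S := {0}) squareTriangleTable.connected
    squareTriangleTable.ncard_edgeSet f hD fun w hm hw => ⟨0, rfl,
      eq_zero_of_weightedDeficiency_squareTriangle_le
        (by rwa [squareTriangleTable.ncard_edgeSet] at hm) hw⟩
  rwa [squareTriangleTable.ncard_edgeSet] at hl₀

lemma IsBicyclic.isom_B2 (hG : IsBicyclic G m) (h : IsTriangle G a b c)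
    (h' : IsTriangle G a x y) (hn : [a, b, c, x, y].Nodup)
    (hD : totalDeficiency G ≤ min 24 (2 * (m : ℤ) + 6)) : Isom G (B2 m) := by
  have f := twoTrianglesTable.copy (G := G) ![a, b, c, x, y]
    (List.nodup_ofFn.1 (by simpa using hn)) (by
      intro t
      fin_cases t
      exacts [h.adj₁₂.symm, h.adj₂₃.symm, h.adj₃₁, h'.adj₁₂.symm, h'.adj₂₃.symm, h'.adj₃₁])
  obtain ⟨l₀, rfl, hl₀⟩ := hG.exists_isom_attachPendants (S := {0}) twoTrianglesTable.connected
    twoTrianglesTable.ncard_edgeSet f hD fun w hm hw => ⟨0, rfl,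
      eq_zero_of_weightedDeficiency_twoTriangles_le
        (by rwa [twoTrianglesTable.ncard_edgeSet] at hm) hw⟩
  rwa [twoTrianglesTable.ncard_edgeSet] at hl₀

lemma IsBicyclic.isom_B3_or_isom_B4 (hG : IsBicyclic G m) (h : IsTriangle G a b c)
    (hax : G.Adj a x) (hxb : G.Adj x b) (hn : [a, b, c, x].Nodup)
    (hD : totalDeficiency G ≤ min 24 (2 * (m : ℤ) + 6)) : Isom G (B3 m) ∨ Isom G (B4 m) := by
  have f := diamondTable.copy (G := G) ![a, b, c, x]
    (List.nodup_ofFn.1 (by simpa using hn)) (by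
      intro t
      fin_cases t
      exacts [h.adj₁₂.symm, h.adj₃₁, h.adj₂₃.symm, hax.symm, hxb])
  obtain ⟨l₀, -, hl₀⟩ := hG.exists_isom_attachPendants (S := .univ) diamondTable.connected
    diamondTable.ncard_edgeSet f hD fun w hm hw => by
      obtain ⟨l₀, hl₀⟩ := exists_eq_zero_of_weightedDeficiency_diamond_le
        (by rwa [diamondTable.ncard_edgeSet] at hm) hw
      exact ⟨l₀, trivial, hl₀⟩
  rw [diamondTable.ncard_edgeSet] at hl₀
  exact hl₀.attachPendants_diamond

lemma IsBicyclic.lt_totalDeficiency_of_copy {W : Type*} [Fintype W] [Nontrivial W]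
    {H : SimpleGraph W} (hG : IsBicyclic G m) (hH : H.Connected)
    (hcard : H.edgeSet.ncard = Fintype.card W + 1) (f : Copy H G) {D : ℤ}
    (hD : ∀ w : W → ℕ, m = H.edgeSet.ncard + ∑ l, w l → D < weightedDeficiency H w) :
    D < totalDeficiency G := by
  obtain ⟨w, hm, hle, -⟩ := hG.exists_weight hH hcard f
  exact (hD w hm).trans_le hle

lemma IsBicyclic.lt_totalDeficiency_of_copy_thetaTwo (hG : IsBicyclic G m)
    (f : Copy thetaTwo G) : min 24 (2 * (m : ℤ) + 6) < totalDeficiency G :=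
  hG.lt_totalDeficiency_of_copy thetaTwoTable.connected thetaTwoTable.ncard_edgeSet f fun _ hm =>
    lt_weightedDeficiency_thetaTwo (by rwa [thetaTwoTable.ncard_edgeSet] at hm)

lemma IsBicyclic.lt_totalDeficiency_of_quadrangle_ear_two (hG : IsBicyclic G m)
    (h : IsQuadrangle G a b c d) (hax : G.Adj a x) (hxc : G.Adj x c)
    (hn : [a, b, c, d, x].Nodup) : min 24 (2 * (m : ℤ) + 6) < totalDeficiency G := by
  refine hG.lt_totalDeficiency_of_copy_thetaTwo (thetaTwoTable.copy ![a, c, b, d, x]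
    (List.nodup_ofFn.1 ?_) ?_)
  · change [a, c, b, d, x].Nodup
    grind
  · intro t
    fin_cases t
    exacts [h.adj₁₂.symm, h.adj₂₃, h.adj₄₁, h.adj₃₄.symm, hax.symm, hxc]

lemma IsBicyclic.lt_totalDeficiency_of_triangle_ear_three (hG : IsBicyclic G m)
    (h : IsTriangle G a b c) (hax : G.Adj a x) (hxy : G.Adj x y) (hyb : G.Adj y b)
    (hn : [a, b, c, x, y].Nodup) : min 24 (2 * (m : ℤ) + 6) < totalDeficiency G := by
  refine hG.lt_totalDeficiency_of_copy houseTable.connected houseTable.ncard_edgeSet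
    (houseTable.copy ![a, b, c, x, y] (List.nodup_ofFn.1 (by simpa using hn)) ?_)
    fun w hm => lt_weightedDeficiency_house (by rwa [houseTable.ncard_edgeSet] at hm)
  intro t
  fin_cases t
  exacts [h.adj₁₂.symm, h.adj₂₃.symm, h.adj₃₁, hax.symm, hxy.symm, hyb]

lemma IsBicyclic.lt_totalDeficiency_of_quadrangle_ear_three_adjacent (hG : IsBicyclic G m)
    (h : IsQuadrangle G a b c d) (hax : G.Adj a x) (hxy : G.Adj x y) (hyb : G.Adj y b)
    (hn : [a, b, c, d, x, y].Nodup) : 24 < totalDeficiency G := by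
  refine hG.lt_totalDeficiency_of_copy dominoTable.connected dominoTable.ncard_edgeSet
    (dominoTable.copy ![a, b, c, d, x, y] (List.nodup_ofFn.1 (by simpa using hn)) ?_)
    fun w _ => lt_weightedDeficiency_domino w
  intro t
  fin_cases t
  exacts [h.adj₁₂.symm, h.adj₂₃.symm, h.adj₃₄, h.adj₄₁, hax.symm, hxy.symm, hyb]

lemma IsBicyclic.lt_totalDeficiency_of_quadrangle_ear_three_opposite (hG : IsBicyclic G m)
    (h : IsQuadrangle G a b c d) (hax : G.Adj a x) (hxy : G.Adj x y) (hyc : G.Adj y c)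
    (hn : [a, b, c, d, x, y].Nodup) : 24 < totalDeficiency G := by
  refine hG.lt_totalDeficiency_of_copy thetaTwoTwoThreeTable.connected
    thetaTwoTwoThreeTable.ncard_edgeSet
    (thetaTwoTwoThreeTable.copy ![a, b, c, d, x, y] (List.nodup_ofFn.1 (by simpa using hn)) ?_)
    fun w _ => lt_weightedDeficiency_thetaTwoTwoThree w
  intro t
  fin_cases t
  exacts [h.adj₁₂.symm, h.adj₂₃, h.adj₃₄.symm, h.adj₄₁, hax.symm, hxy.symm, hyc]

end Recognition

section DisjointCycles

variable {V : Type*} [Fintype V] {G : SimpleGraph V} {u v : V}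

-- A walk from `c` to `c'` leaves `c`, together with the vertices hanging from it, through an edge
-- both of whose ends have further neighbours.
lemma exists_adj_two_le_deficiency (hG : G.Connected) {c : G.Walk u u} {c' : G.Walk v v}
    (hc : c.IsCycle) (hc' : c'.IsCycle) (hd : c.support.Disjoint c'.support) :
    ∃ x y, G.Adj x y ∧ x ∈ c.support ∧ y ∉ c.support ∧ 2 ≤ deficiency G s(x, y) := by
  let S : Set V := {w | w ∈ c.support ∨ ∃ x ∈ c.support, ∀ y, G.Adj w y → y = x}
  have hv : v ∉ S := by
    rintro (hv | ⟨x, -, hx⟩)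
    · exact hd hv c'.start_mem_support
    · obtain ⟨a, b, hab, ha, hb⟩ := exists_mem_edges_of_isCycle hc' c'.start_mem_support
      exact hab ((hx a (c'.adj_of_mem_edges ha)).trans (hx b (c'.adj_of_mem_edges hb)).symm)
  obtain ⟨p⟩ := hG.preconnected u v
  obtain ⟨⟨⟨x, y⟩, hxy⟩, -, hxS, hyS⟩ := p.exists_boundary_dart S (.inl c.start_mem_support) hv
  have hy : y ∉ c.support := fun hy => hyS (.inl hy)
  have hx : x ∈ c.support := by
    obtain hx | ⟨z, hz, hxz⟩ := hxS
    · exact hx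
    · exact absurd (hxz y hxy ▸ hz) hy
  obtain ⟨z, hyz, hzx⟩ : ∃ z, G.Adj y z ∧ z ≠ x := by
    by_contra! hall
    exact hyS (.inr ⟨x, hx, hall⟩)
  obtain ⟨a, -, -, ha, -⟩ := exists_mem_edges_of_isCycle hc hx
  refine ⟨x, y, hxy, hx, hy, two_le_deficiency hG hxy (c.adj_of_mem_edges ha) ?_ hyz hzx⟩
  rintro rfl
  exact hy (c.snd_mem_support_of_mem_edges ha)

lemma sum_add_sum_lt_totalDeficiency [DecidableEq V] (hG : G.Connected) {c : G.Walk u u}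
    {c' : G.Walk v v} (hc : c.IsCycle) (hc' : c'.IsCycle)
    (hd : c.support.Disjoint c'.support) :
    ∑ f ∈ c.edges.toFinset, deficiency G f + ∑ f ∈ c'.edges.toFinset, deficiency G f <
      totalDeficiency G := by
  obtain ⟨x, y, hxy, hx, hy, hpos⟩ := exists_adj_two_le_deficiency hG hc hc' hd
  have hdisj : Disjoint c.edges.toFinset c'.edges.toFinset := disjoint_left.2 fun f hf hf' => by
    rw [List.mem_toFinset] at hf hf'
    induction f with | _ a b
    exact hd (c.fst_mem_support_of_mem_edges hf) (c'.fst_mem_support_of_mem_edges hf')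
  have hnot : s(x, y) ∉ c.edges.toFinset ∪ c'.edges.toFinset := by
    simp only [mem_union, List.mem_toFinset, not_or]
    exact ⟨fun h => hy (c.snd_mem_support_of_mem_edges h),
      fun h => hd hx (c'.fst_mem_support_of_mem_edges h)⟩
  have hle := sum_deficiency_le_totalDeficiency hG
    (K := insert s(x, y) (c.edges.toFinset ∪ c'.edges.toFinset)) (by
      simp only [mem_insert, mem_union, List.mem_toFinset, forall_eq_or_imp]
      exact ⟨hxy, fun f hf => hf.elim (c.edges_subset_edgeSet ·) (c'.edges_subset_edgeSet ·)⟩)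
  rw [sum_insert hnot, sum_union hdisj] at hle
  linarith

end DisjointCycles

section ShortEars

variable {V : Type*} {G : SimpleGraph V} {X : Set V} {u v : V}

/-- `X` contains all cycles of length at most 4, and two distinct vertices of `X` are never joined
by a path of length 2 or 3 with inner vertices outside `X`. Every edge that lies on a cycle and
leaves `X` is then expensive. -/
structure EnclosesShortCycles (G : SimpleGraph V) (X : Set V) : Prop where
  triangle_mem {p q r : V} : IsTriangle G p q r → p ∈ X
  quadrangle_mem {p q r s : V} : IsQuadrangle G p q r s → p ∈ X
  ear_two {p x q : V} : p ∈ X → q ∈ X → p ≠ q → x ∉ X → G.Adj p x → ¬ G.Adj x q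
  ear_three {p x y q : V} : p ∈ X → q ∈ X → p ≠ q → x ∉ X → y ∉ X → G.Adj p x → G.Adj x y →
    ¬ G.Adj y q

namespace EnclosesShortCycles

lemma exists_three_consecutive_edges (hX : EnclosesShortCycles G X) (h : OnCycle G s(u, v))
    (hv : v ∉ X) :
    ∃ a b c d, OnCycle G s(a, b) ∧ OnCycle G s(b, c) ∧ OnCycle G s(c, d) ∧ b ∉ X ∧ c ∉ X ∧
      a ≠ c ∧ b ≠ d := by
  obtain ⟨w, hwu, hvw⟩ := h.exists_next
  by_cases hw : w ∈ X
  · have hu : u ∉ X := fun hu => hX.ear_two hu hw hwu.symm hv h.adj hvw.adj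
    obtain ⟨z, hzv, huz⟩ := h.symm.exists_next
    exact ⟨w, v, u, z, hvw.symm, h.symm, huz, hv, hu, hwu, hzv.symm⟩
  · obtain ⟨z, hzv, hwz⟩ := hvw.exists_next
    exact ⟨u, v, w, z, h, hvw, hwz, hv, hw, hwu.symm, hzv.symm⟩

lemma exists_four_consecutive_edges (hX : EnclosesShortCycles G X) (h : OnCycle G s(u, v))
    (hv : v ∉ X) :
    ∃ a b c d e, OnCycle G s(a, b) ∧ OnCycle G s(b, c) ∧ OnCycle G s(c, d) ∧ OnCycle G s(d, e) ∧
      b ∉ X ∧ c ∉ X ∧ d ∉ X ∧ a ≠ c ∧ b ≠ d ∧ a ≠ d ∧ c ≠ e := by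
  obtain ⟨a, b, c, d, hab, hbc, hcd, hb, hc, hac, hbd⟩ := hX.exists_three_consecutive_edges h hv
  have had : a ≠ d := by
    rintro rfl
    exact hb (hX.triangle_mem ⟨hbc.adj, hcd.adj, hab.adj⟩)
  by_cases hd : d ∈ X
  · have ha : a ∉ X := fun ha => hX.ear_three ha hd had hb hc hab.adj hbc.adj hcd.adj
    obtain ⟨e, heb, hae⟩ := hab.symm.exists_next
    exact ⟨d, c, b, a, e, hcd.symm, hbc.symm, hab.symm, hae, hc, hb, ha, hbd.symm, hac.symm,
      had.symm, heb.symm⟩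
  · obtain ⟨e, hec, hde⟩ := hcd.exists_next
    exact ⟨a, b, c, d, e, hab, hbc, hcd, hde, hb, hc, hd, hac, hbd, had, hec.symm⟩

variable [Fintype V]

lemma four_le_deficiency (hX : EnclosesShortCycles G X) (hG : G.Connected)
    (h : OnCycle G s(u, v)) (hv : v ∉ X) : 4 ≤ deficiency G s(u, v) :=
  EdgeMostar.four_le_deficiency hG h (fun _ ht => hv (hX.triangle_mem ht.rotate))
    fun _ _ hq => hv (hX.quadrangle_mem hq.rotate)

lemma sum_add_sixteen_le_totalDeficiency (hX : EnclosesShortCycles G X) (hG : G.Connected)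
    (h : OnCycle G s(u, v)) (hv : v ∉ X) {A : Finset (Sym2 V)}
    (hA : ∀ f ∈ A, f ∈ G.edgeSet ∧ ∀ x ∈ f, x ∈ X) :
    ∑ f ∈ A, deficiency G f + 16 ≤ totalDeficiency G := by
  classical
  obtain ⟨a, b, c, d, e, hab, hbc, hcd, hde, hb, hc, hd, hac, hbd, had, hce⟩ :=
    hX.exists_four_consecutive_edges h hv
  let K : Finset (Sym2 V) := {s(a, b), s(b, c), s(c, d), s(e, d)}
  have hK : ∑ f ∈ K, deficiency G f = deficiency G s(a, b) + (deficiency G s(b, c) +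
      (deficiency G s(c, d) + deficiency G s(e, d))) := by
    rw [sum_insert, sum_insert, sum_pair]
    · simp [hce, hcd.adj.ne]
    · simp [hbc.adj.ne, hbd, hcd.adj.ne]
    · simp [hab.adj.ne, hac, hbc.adj.ne, had, hbd]
  have hdisj : Disjoint A K := disjoint_left.2 fun f hf hfK => by
    have hfX := (hA f hf).2
    simp only [K, mem_insert, mem_singleton] at hfK
    obtain rfl | rfl | rfl | rfl := hfK
    exacts [hb (hfX b (by simp)), hb (hfX b (by simp)), hc (hfX c (by simp)),
      hd (hfX d (by simp))]
  have hle := sum_deficiency_le_totalDeficiency hG (K := A ∪ K) (by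
    simp only [K, mem_union, mem_insert, mem_singleton]
    rintro f (hf | rfl | rfl | rfl | rfl)
    exacts [(hA f hf).1, hab.mem_edgeSet, hbc.mem_edgeSet, hcd.mem_edgeSet,
      hde.symm.mem_edgeSet])
  rw [sum_union hdisj, hK] at hle
  linarith [hX.four_le_deficiency hG hab hb, hX.four_le_deficiency hG hbc hc,
    hX.four_le_deficiency hG hcd hd, hX.four_le_deficiency hG hde.symm hd]

end EnclosesShortCycles

end ShortEars

section Classification

variable {V : Type*} {G : SimpleGraph V} {m : ℕ} {u p q r s x y z : V} {c : G.Walk u u}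

lemma IsTriangle.nodup (h : IsTriangle G p q r) : [p, q, r].Nodup := by
  simp [h.adj₁₂.ne, h.adj₂₃.ne, h.adj₃₁.ne']

lemma IsQuadrangle.nodup (h : IsQuadrangle G p q r s) : [p, q, r, s].Nodup := by
  simp [h.adj₁₂.ne, h.adj₂₃.ne, h.adj₃₄.ne, h.adj₄₁.ne', h.ne₁₃, h.ne₂₄]

lemma exists_isTriangle_of_mem_support (hl : c.length = 3) (hp : p ∈ c.support) :
    ∃ q r, IsTriangle G p q r ∧ ∀ x, x ∈ c.support ↔ x ∈ [p, q, r] := by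
  classical
  obtain ⟨q, r, h, heq⟩ := exists_isTriangle_rotate_eq hl hp
  refine ⟨q, r, h, fun x => ?_⟩
  rw [← c.mem_support_rotate_iff p hp, heq]
  simp only [IsTriangle.walk, Walk.support_cons, Walk.support_nil, List.mem_cons]
  tauto

lemma exists_isQuadrangle_of_mem_support (hc : c.IsCycle) (hl : c.length = 4)
    (hp : p ∈ c.support) :
    ∃ q r s, IsQuadrangle G p q r s ∧ ∀ x, x ∈ c.support ↔ x ∈ [p, q, r, s] := by
  classical
  obtain ⟨q, r, s, h, heq⟩ := exists_isQuadrangle_rotate_eq hc hl hp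
  refine ⟨q, r, s, h, fun x => ?_⟩
  rw [← c.mem_support_rotate_iff p hp, heq]
  simp only [IsQuadrangle.walk, Walk.support_cons, Walk.support_nil, List.mem_cons]
  tauto

lemma exists_isTriangle_of_mem_support_of_ne (hl : c.length = 3) (hp : p ∈ c.support)
    (hq : q ∈ c.support) (hpq : p ≠ q) :
    ∃ r, IsTriangle G p q r ∧ ∀ x, x ∈ c.support ↔ x ∈ [p, q, r] := by
  obtain ⟨a, b, h, hmem⟩ := exists_isTriangle_of_mem_support hl hp
  obtain rfl | rfl | rfl : q = p ∨ q = a ∨ q = b := by simpa using (hmem q).1 hq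
  · exact absurd rfl hpq
  · exact ⟨b, h, hmem⟩
  · exact ⟨a, h.reverse.rotate.rotate, fun x => by grind⟩

lemma exists_isQuadrangle_of_mem_support_of_ne (hc : c.IsCycle) (hl : c.length = 4)
    (hp : p ∈ c.support) (hq : q ∈ c.support) (hpq : p ≠ q) :
    ∃ r s, (IsQuadrangle G p q r s ∨ IsQuadrangle G p r q s) ∧
      ∀ x, x ∈ c.support ↔ x ∈ [p, q, r, s] := by
  obtain ⟨a, b, d, h, hmem⟩ := exists_isQuadrangle_of_mem_support hc hl hp
  obtain rfl | rfl | rfl | rfl : q = p ∨ q = a ∨ q = b ∨ q = d := by simpa using (hmem q).1 hq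
  · exact absurd rfl hpq
  · exact ⟨b, d, .inl h, hmem⟩
  · exact ⟨a, d, .inr h, fun x => by grind⟩
  · exact ⟨b, a, .inl h.reverse.rotate.rotate.rotate, fun x => by grind⟩

/-- `G` is one of the graphs `B_m, B¹_m, …, B⁴_m`. -/
def IsExtremal (G : SimpleGraph V) (m : ℕ) : Prop :=
  Isom G (B m) ∨ Isom G (B1 m) ∨ Isom G (B2 m) ∨ Isom G (B3 m) ∨ Isom G (B4 m)

variable [Fintype V]

lemma IsBicyclic.isExtremal_of_ear_two (hG : IsBicyclic G m)
    (hD : totalDeficiency G ≤ min 24 (2 * (m : ℤ) + 6)) (hc : c.IsCycle) (hg : c.length = G.girth)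
    (hl : c.length ≤ 4) (hp : p ∈ c.support) (hq : q ∈ c.support) (hpq : p ≠ q)
    (hx : x ∉ c.support) (hpx : G.Adj p x) (hxq : G.Adj x q) : IsExtremal G m := by
  obtain h3 | h4 : c.length = 3 ∨ c.length = 4 := by have := hc.three_le_length; omega
  · obtain ⟨r, h, hmem⟩ := exists_isTriangle_of_mem_support_of_ne h3 hp hq hpq
    exact .inr <| .inr <| .inr <| hG.isom_B3_or_isom_B4 h hpx hxq (by grind [h.nodup]) hD
  · obtain ⟨r, s, h | h, hmem⟩ := exists_isQuadrangle_of_mem_support_of_ne hc h4 hp hq hpq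
    · exact absurd ⟨hpx, hxq, h.adj₁₂.symm⟩ (not_isTriangle_of_three_lt_girth (by omega) p x q)
    · exact absurd (hG.lt_totalDeficiency_of_quadrangle_ear_two h hpx hxq (by grind [h.nodup]))
        hD.not_gt

lemma IsBicyclic.lt_totalDeficiency_of_ear_three (hG : IsBicyclic G m) (hc : c.IsCycle)
    (hl : c.length ≤ 4) (hp : p ∈ c.support) (hq : q ∈ c.support) (hpq : p ≠ q)
    (hx : x ∉ c.support) (hy : y ∉ c.support) (hpx : G.Adj p x) (hxy : G.Adj x y)
    (hyq : G.Adj y q) : min 24 (2 * (m : ℤ) + 6) < totalDeficiency G := by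
  have hne := hxy.ne
  obtain h3 | h4 : c.length = 3 ∨ c.length = 4 := by have := hc.three_le_length; omega
  · obtain ⟨r, h, hmem⟩ := exists_isTriangle_of_mem_support_of_ne h3 hp hq hpq
    exact hG.lt_totalDeficiency_of_triangle_ear_three h hpx hxy hyq (by grind [h.nodup])
  · obtain ⟨r, s, h | h, hmem⟩ := exists_isQuadrangle_of_mem_support_of_ne hc h4 hp hq hpq
    · exact min_lt_of_left_lt
        (hG.lt_totalDeficiency_of_quadrangle_ear_three_adjacent h hpx hxy hyq (by grind [h.nodup]))
    · exact min_lt_of_left_lt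
        (hG.lt_totalDeficiency_of_quadrangle_ear_three_opposite h hpx hxy hyq (by grind [h.nodup]))

lemma IsBicyclic.isExtremal_of_touching_triangle (hG : IsBicyclic G m)
    (hD : totalDeficiency G ≤ min 24 (2 * (m : ℤ) + 6)) (hc : c.IsCycle) (hg : c.length = G.girth)
    (h : IsTriangle G p y z) (hp : p ∈ c.support) (hy : y ∉ c.support) (hz : z ∉ c.support) :
    IsExtremal G m := by
  have h3 : c.length = 3 :=
    le_antisymm (hg.trans_le (girth_le_length h.isCycle_walk)) hc.three_le_length
  obtain ⟨q, r, ht, hmem⟩ := exists_isTriangle_of_mem_support h3 hp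
  exact .inr <| .inr <| .inl <| hG.isom_B2 ht h (by grind [ht.nodup, h.nodup]) hD

lemma IsBicyclic.isExtremal_of_touching_quadrangle (hG : IsBicyclic G m)
    (hD : totalDeficiency G ≤ min 24 (2 * (m : ℤ) + 6)) (hc : c.IsCycle) (hl : c.length ≤ 4)
    (h : IsQuadrangle G p x y z) (hp : p ∈ c.support) (hx : x ∉ c.support) (hy : y ∉ c.support)
    (hz : z ∉ c.support) : IsExtremal G m := by
  obtain h3 | h4 : c.length = 3 ∨ c.length = 4 := by have := hc.three_le_length; omega
  · obtain ⟨q, r, ht, hmem⟩ := exists_isTriangle_of_mem_support h3 hp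
    exact .inr <| .inl <| hG.isom_B1 h ht (by grind [ht.nodup, h.nodup]) hD
  · obtain ⟨q, r, s, hq, hmem⟩ := exists_isQuadrangle_of_mem_support hc h4 hp
    exact .inl <| hG.isom_B hq h (by grind [hq.nodup, h.nodup]) (hD.trans (min_le_left _ _))

lemma IsBicyclic.lt_totalDeficiency_of_disjoint {v : V} (hG : IsBicyclic G m)
    (hc : c.IsCycle) (hl : c.length ≤ 4) {c' : G.Walk v v} (hc' : c'.IsCycle)
    (hl' : c'.length ≤ 4) (hd : c.support.Disjoint c'.support) :
    min 24 (2 * (m : ℤ) + 6) < totalDeficiency G := by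
  classical
  have hlt := sum_add_sum_lt_totalDeficiency hG.1 hc hc' hd
  have h := min_le_sum_deficiency hG.1 hc hl
  have h' := min_le_sum_deficiency hG.1 hc' hl'
  rw [hG.2.2] at h h'
  omega

lemma IsBicyclic.isExtremal_of_isTriangle_of_notMem (hG : IsBicyclic G m)
    (hD : totalDeficiency G ≤ min 24 (2 * (m : ℤ) + 6)) (hc : c.IsCycle) (hg : c.length = G.girth)
    (hl : c.length ≤ 4) (h : IsTriangle G x y z) (hx : x ∉ c.support) : IsExtremal G m := by
  by_cases hy : y ∈ c.support <;> by_cases hz : z ∈ c.support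
  · exact hG.isExtremal_of_ear_two hD hc hg hl hz hy h.adj₂₃.ne' hx h.adj₃₁ h.adj₁₂
  · exact hG.isExtremal_of_touching_triangle hD hc hg h.rotate hy hz hx
  · exact hG.isExtremal_of_touching_triangle hD hc hg h.rotate.rotate hz hx hy
  · refine absurd (hG.lt_totalDeficiency_of_disjoint hc hl h.isCycle_walk ?_ ?_) hD.not_gt
    · simp [IsTriangle.walk]
    · simp [IsTriangle.walk, List.disjoint_right, hx, hy, hz]

lemma IsBicyclic.isExtremal_of_isQuadrangle_of_notMem (hG : IsBicyclic G m)
    (hD : totalDeficiency G ≤ min 24 (2 * (m : ℤ) + 6)) (hc : c.IsCycle) (hg : c.length = G.girth)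
    (hl : c.length ≤ 4) (h : IsQuadrangle G x y z s) (hx : x ∉ c.support) :
    IsExtremal G m := by
  by_cases hy : y ∈ c.support <;> by_cases hs : s ∈ c.support
  · exact hG.isExtremal_of_ear_two hD hc hg hl hy hs h.ne₂₄ hx h.adj₁₂.symm h.adj₄₁.symm
  all_goals by_cases hz : z ∈ c.support
  · exact absurd (hG.lt_totalDeficiency_of_ear_three hc hl hy hz h.adj₂₃.ne hx hs h.adj₁₂.symm
      h.adj₄₁.symm h.adj₃₄.symm) hD.not_gt
  · exact hG.isExtremal_of_touching_quadrangle hD hc hl h.rotate hy hz hs hx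
  · exact absurd (hG.lt_totalDeficiency_of_ear_three hc hl hs hz h.adj₃₄.ne' hx hy h.adj₄₁
      h.adj₁₂ h.adj₂₃) hD.not_gt
  · exact hG.isExtremal_of_touching_quadrangle hD hc hl h.rotate.rotate.rotate hs hx hy hz
  · exact hG.isExtremal_of_touching_quadrangle hD hc hl h.rotate.rotate hz hs hx hy
  · refine absurd (hG.lt_totalDeficiency_of_disjoint hc hl h.isCycle_walk ?_ ?_) hD.not_gt
    · simp [IsQuadrangle.walk]
    · simp [IsQuadrangle.walk, List.disjoint_right, hx, hy, hz, hs]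

lemma IsBicyclic.enclosesShortCycles (hG : IsBicyclic G m)
    (hD : totalDeficiency G ≤ min 24 (2 * (m : ℤ) + 6)) (hc : c.IsCycle) (hg : c.length = G.girth)
    (hl : c.length ≤ 4) (hext : ¬ IsExtremal G m) : EnclosesShortCycles G {v | v ∈ c.support} where
  triangle_mem h := by
    by_contra hx
    exact hext (hG.isExtremal_of_isTriangle_of_notMem hD hc hg hl h hx)
  quadrangle_mem h := by
    by_contra hx
    exact hext (hG.isExtremal_of_isQuadrangle_of_notMem hD hc hg hl h hx)
  ear_two hp hq hpq hx hpx hxq :=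
    hext (hG.isExtremal_of_ear_two hD hc hg hl hp hq hpq hx hpx hxq)
  ear_three hp hq hpq hx hy hpx hxy hyq :=
    (hG.lt_totalDeficiency_of_ear_three hc hl hp hq hpq hx hy hpx hxy hyq).not_ge hD

theorem IsBicyclic.isExtremal_of_totalDeficiency_le (hG : IsBicyclic G m)
    (hD : totalDeficiency G ≤ min 24 (2 * (m : ℤ) + 6)) : IsExtremal G m := by
  classical
  obtain ⟨hconn, hcard, hm⟩ := hG
  have hG : IsBicyclic G m := ⟨hconn, hcard, hm⟩
  obtain ⟨u, c, hc, hg⟩ := exists_isCycle_length_eq_girth hconn (by omega)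
  have hl : c.length ≤ 4 := by
    by_contra!
    have := twenty_eight_le_totalDeficiency hconn (by omega) (by omega)
    omega
  by_contra hext
  obtain ⟨x, y, hxy, hy⟩ := exists_onCycle_notMem_support hconn (by omega) hc hg
  have hle := (hG.enclosesShortCycles hD hc hg hl hext).sum_add_sixteen_le_totalDeficiency hconn hxy
    hy (A := c.edges.toFinset) fun f hf => by
      rw [List.mem_toFinset] at hf
      exact ⟨c.edges_subset_edgeSet hf, fun x hx => Walk.mem_support_of_mem_edges hf hx⟩
  have hmin := min_le_sum_deficiency hconn hc hl
  rw [hm] at hmin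
  omega

end Classification

section Extremal

variable {V : Type*} [Fintype V] {G : SimpleGraph V} {m : ℕ}

lemma IsBicyclic.ncard_add_eq_of_isom_attachPendants {W : Type*} [Finite W] {H : SimpleGraph W}
    {l₀ : W} {p : ℕ} (hG : IsBicyclic G m) (h : Isom G (attachPendants H l₀ p)) :
    H.edgeSet.ncard + p = m := by
  rw [← ncard_edgeSet_attachPendants H l₀, ← ncard_edgeSet_eq_of_iso h.some, hG.2.2]

lemma IsBicyclic.seven_le_of_isom_B1 (hG : IsBicyclic G m) (h : Isom G (B1 m)) : 7 ≤ m := by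
  have := hG.ncard_add_eq_of_isom_attachPendants h
  rw [squareTriangleTable.ncard_edgeSet] at this
  omega

lemma IsBicyclic.six_le_of_isom_B2 (hG : IsBicyclic G m) (h : Isom G (B2 m)) : 6 ≤ m := by
  have := hG.ncard_add_eq_of_isom_attachPendants h
  rw [twoTrianglesTable.ncard_edgeSet] at this
  omega

lemma IsBicyclic.min_le_totalDeficiency (hG : IsBicyclic G m) (hm : 5 ≤ m) :
    min 24 (2 * (m : ℤ) + 6) ≤ totalDeficiency G := by
  by_contra! hlt
  rcases hG.isExtremal_of_totalDeficiency_le hlt.le with h | h | h | h | h <;>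
    rw [h.totalDeficiency_eq hG.1] at hlt
  · rw [totalDeficiency_B] at hlt
    omega
  · rw [totalDeficiency_B1 (hG.seven_le_of_isom_B1 h)] at hlt
    omega
  · rw [totalDeficiency_B2 (hG.six_le_of_isom_B2 h)] at hlt
    omega
  · rw [totalDeficiency_B3 hm] at hlt
    omega
  · obtain rfl | hm := hm.eq_or_lt
    · rw [totalDeficiency_B4_five] at hlt
      omega
    · rw [totalDeficiency_B4 hm] at hlt
      omega

lemma IsBicyclic.edgeMostar_eq (hG : IsBicyclic G m) :
    edgeMostar G = (m : ℤ) ^ 2 - m - totalDeficiency G := by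
  rw [edgeMostar_eq_sub_totalDeficiency, hG.2.2]
  ring

theorem IsBicyclic.edgeMostar_five (hG : IsBicyclic G m) (hm : m = 5) :
    edgeMostar G ≤ 4 ∧ (edgeMostar G = 4 ↔ Isom G (B3 m) ∨ Isom G (B4 m)) := by
  subst hm
  have hmin := hG.min_le_totalDeficiency le_rfl
  have hmo := hG.edgeMostar_eq
  refine ⟨by omega, fun heq => ?_, ?_⟩
  · rcases hG.isExtremal_of_totalDeficiency_le (by omega) with h | h | h | h | h
    · have := h.totalDeficiency_eq hG.1
      rw [totalDeficiency_B] at this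
      omega
    · exact absurd (hG.seven_le_of_isom_B1 h) (by omega)
    · exact absurd (hG.six_le_of_isom_B2 h) (by omega)
    · exact .inl h
    · exact .inr h
  · rintro (h | h)
    · rw [hmo, h.totalDeficiency_eq hG.1, totalDeficiency_B3 le_rfl]
      norm_num
    · rw [hmo, h.totalDeficiency_eq hG.1, totalDeficiency_B4_five]
      norm_num

theorem IsBicyclic.edgeMostar_six_to_eight (hG : IsBicyclic G m) (hm : 6 ≤ m) (hm' : m ≤ 8) :
    edgeMostar G ≤ (m : ℤ) ^ 2 - 3 * m - 6 ∧
      (edgeMostar G = (m : ℤ) ^ 2 - 3 * m - 6 ↔ Isom G (B2 m) ∨ Isom G (B3 m)) := by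
  have hmin := hG.min_le_totalDeficiency (by omega)
  rw [hG.edgeMostar_eq]
  refine ⟨by omega, fun heq => ?_, ?_⟩
  · rcases hG.isExtremal_of_totalDeficiency_le (by omega) with h | h | h | h | h
    · have := h.totalDeficiency_eq hG.1
      rw [totalDeficiency_B] at this
      omega
    · have := h.totalDeficiency_eq hG.1
      rw [totalDeficiency_B1 (hG.seven_le_of_isom_B1 h)] at this
      omega
    · exact .inl h
    · exact .inr h
    · have := h.totalDeficiency_eq hG.1
      rw [totalDeficiency_B4 hm] at this
      omega
  · rintro (h | h)
    · rw [h.totalDeficiency_eq hG.1, totalDeficiency_B2 hm]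
      ring
    · rw [h.totalDeficiency_eq hG.1, totalDeficiency_B3 (by omega)]
      ring

theorem IsBicyclic.edgeMostar_nine (hG : IsBicyclic G m) (hm : m = 9) :
    edgeMostar G ≤ 48 ∧ (edgeMostar G = 48 ↔
      Isom G (B m) ∨ Isom G (B1 m) ∨ Isom G (B2 m) ∨ Isom G (B3 m) ∨ Isom G (B4 m)) := by
  subst hm
  have hmin := hG.min_le_totalDeficiency (by omega)
  have hmo := hG.edgeMostar_eq
  refine ⟨by omega, fun heq => hG.isExtremal_of_totalDeficiency_le (by omega), ?_⟩
  rintro (h | h | h | h | h) <;> rw [hmo, h.totalDeficiency_eq hG.1]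
  · rw [totalDeficiency_B]
    norm_num
  · rw [totalDeficiency_B1 (by omega)]
    norm_num
  · rw [totalDeficiency_B2 (by omega)]
    norm_num
  · rw [totalDeficiency_B3 (by omega)]
    norm_num
  · rw [totalDeficiency_B4 (by omega)]
    norm_num

theorem IsBicyclic.edgeMostar_ge_ten (hG : IsBicyclic G m) (hm : 10 ≤ m) :
    edgeMostar G ≤ (m : ℤ) ^ 2 - m - 24 ∧
      (edgeMostar G = (m : ℤ) ^ 2 - m - 24 ↔ Isom G (B m)) := by
  have hmin := hG.min_le_totalDeficiency (by omega)
  rw [hG.edgeMostar_eq]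
  refine ⟨by omega, fun heq => ?_, fun h => by rw [h.totalDeficiency_eq hG.1, totalDeficiency_B]⟩
  rcases hG.isExtremal_of_totalDeficiency_le (by omega) with h | h | h | h | h
  · exact h
  · have := h.totalDeficiency_eq hG.1
    rw [totalDeficiency_B1 (by omega)] at this
    omega
  · have := h.totalDeficiency_eq hG.1
    rw [totalDeficiency_B2 (by omega)] at this
    omega
  · have := h.totalDeficiency_eq hG.1
    rw [totalDeficiency_B3 (by omega)] at this
    omega
  · have := h.totalDeficiency_eq hG.1
    rw [totalDeficiency_B4 (by omega)] at this
    omega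

lemma isBicyclic_B (hm : 8 ≤ m) : IsBicyclic (B m) m := by
  have hcard := twoSquaresTable.ncard_edgeSet
  have h := isBicyclic_attachPendants twoSquaresTable.connected hcard 0 (m - 8)
  rwa [hcard, Nat.add_sub_cancel' hm] at h

lemma isBicyclic_B5 (hm : 6 ≤ m) : IsBicyclic (B5 m) m := by
  have hcard := thetaTwoTable.ncard_edgeSet
  have h := isBicyclic_attachPendants thetaTwoTable.connected hcard 2 (m - 6)
  rwa [hcard, Nat.add_sub_cancel' hm] at h

lemma isMaximizer_B (hm : 10 ≤ m) : IsMaximizer (B m) m := by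
  have hB : IsBicyclic (B m) m := isBicyclic_B (by omega)
  refine ⟨hB, fun n G hG => ?_⟩
  rw [(hB.edgeMostar_ge_ten hm).2.2 ⟨Iso.refl⟩]
  exact (hG.edgeMostar_ge_ten hm).1

lemma edgeMostar_B5_lt (hm : 10 ≤ m) : edgeMostar (B5 m) < (m : ℤ) ^ 2 - m - 24 := by
  have hB : IsBicyclic (B5 m) m := isBicyclic_B5 (by omega)
  let f : Copy thetaTwo (B5 m) := ⟨⟨Sum.inl, id⟩, Sum.inl_injective⟩
  have hlt := hB.lt_totalDeficiency_of_copy_thetaTwo f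
  rw [hB.edgeMostar_eq]
  omega

lemma not_isMaximizer_B5 (hm : 10 ≤ m) : ¬ IsMaximizer (B5 m) m := by
  rintro ⟨-, hmax⟩
  let e := Fintype.equivFin (Fin 7 ⊕ Fin (m - 8))
  let φ : B m ≃g (B m).map e.toEmbedding := Iso.map e (B m)
  have hG := (isBicyclic_B (m := m) (by omega)).of_iso φ
  have hle := hmax _ _ hG
  rw [(hG.edgeMostar_ge_ten hm).2.2 ⟨φ.symm⟩] at hle
  exact (edgeMostar_B5_lt hm).not_ge hle

end Extremal

end EdgeMostar

theorem theorem1 :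
    (∀ (V : Type*) [Fintype V] (G : SimpleGraph V) (m : ℕ), 5 ≤ m → EdgeMostar.IsBicyclic G m →
      (m = 5 →
        EdgeMostar.edgeMostar G ≤ 4 ∧
        (EdgeMostar.edgeMostar G = 4 ↔
          EdgeMostar.Isom G (EdgeMostar.B3 m) ∨ EdgeMostar.Isom G (EdgeMostar.B4 m))) ∧
      (6 ≤ m → m ≤ 8 →
        EdgeMostar.edgeMostar G ≤ (m : ℤ) ^ 2 - 3 * (m : ℤ) - 6 ∧
        (EdgeMostar.edgeMostar G = (m : ℤ) ^ 2 - 3 * (m : ℤ) - 6 ↔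
          EdgeMostar.Isom G (EdgeMostar.B2 m) ∨ EdgeMostar.Isom G (EdgeMostar.B3 m))) ∧
      (m = 9 →
        EdgeMostar.edgeMostar G ≤ 48 ∧
        (EdgeMostar.edgeMostar G = 48 ↔
          EdgeMostar.Isom G (EdgeMostar.B m) ∨ EdgeMostar.Isom G (EdgeMostar.B1 m) ∨
          EdgeMostar.Isom G (EdgeMostar.B2 m) ∨ EdgeMostar.Isom G (EdgeMostar.B3 m) ∨
          EdgeMostar.Isom G (EdgeMostar.B4 m))) ∧
      (10 ≤ m →
        EdgeMostar.edgeMostar G ≤ (m : ℤ) ^ 2 - (m : ℤ) - 24 ∧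
        (EdgeMostar.edgeMostar G = (m : ℤ) ^ 2 - (m : ℤ) - 24 ↔
          EdgeMostar.Isom G (EdgeMostar.B m)))) ∧
    (∀ m : ℕ, 10 ≤ m →
      EdgeMostar.IsMaximizer (EdgeMostar.B m) m ∧
      EdgeMostar.IsBicyclic (EdgeMostar.B5 m) m ∧ ¬ EdgeMostar.IsMaximizer (EdgeMostar.B5 m) m) ∧
    ¬ EdgeMostar.LiuConjecture := by
  refine ⟨fun V _ G m _ hG => ⟨hG.edgeMostar_five, hG.edgeMostar_six_to_eight,
    hG.edgeMostar_nine, hG.edgeMostar_ge_ten⟩, fun m hm => ⟨EdgeMostar.isMaximizer_B hm,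
    EdgeMostar.isBicyclic_B5 (by omega), EdgeMostar.not_isMaximizer_B5 hm⟩, ?_⟩
  rintro ⟨M, hM⟩
  exact EdgeMostar.not_isMaximizer_B5 (le_max_right M 10) (hM _ (le_max_left M 10)).2
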